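/- A knot is a smooth embedding $\gamma: S^1=\mathbb{R}/\mathbb{Z}\to\mathbb{R}^3$ with image $K$; a framing of $K$ is a smooth unit normal vector field $\nu: S^1\to S^2$ along $\gamma$. The spaces of knots and of framings of a fixed knot carry the $C^\infty$ topology, and "generic" means "belonging to some open dense subset". A cord is a straight segment from $\gamma(s)$ to $\gamma(t)$; cords are identified with points $(s,t)\in S^1\times S^1\cong K\times K$. Let $E(s,t)=\frac12|\gamma(s)-\gamma(t)|^2$ be the energy function, and let $\pi_s$ be the orthogonal projection of $\mathbb{R}^3$ onto the normal plane $\gamma'(s)^\perp$. For a base point $\gamma(p)$ and a framing $\nu$ put - $B=\{(s,t): s=p \text{ or } t=p\}$, the cords that start or end at the base point; - $F=F^s\cup F^e$, the cords that intersect the framing, where $F^s=\{(s,t): \pi_s(\gamma(t)-\gamma(s))=\alpha\,\nu(s)\text{ for some }\alpha>0\}$ and $F^e=\{(s,t):(t,s)\in F^s\}$; - $S=\{(s,t): s\neq t,\ \text{the open segment from }\gamma(s)\text{ to }\gamma(t)\text{ meets }K\}$, the cords that meet the knot in their interior. For a Morse function $h$ on $S^1\times S^1$ let $\mathrm{Crit}_k(h)$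 be the set of its critical points of Morse index $k$. **Lemma.** For a generic knot $K$ there is a neighbourhood $U$ of the diagonal in $K\times K$ such that the following holds for every smooth function $f: K\times K\to\mathbb{R}$ that vanishes outside $U$ and for which $E+f$ is a Morse function. For a generic base point and a generic framing (depending on $K$ and $f$), $$\bigl(\mathrm{Crit}_0(E+f)\cup\mathrm{Crit}_1(E+f)\bigr)\cap\bigl(B\cup \overline{F}\cup\overline{S}\bigr)=\emptyset ,$$ where $\overline F$ and $\overline S$ denote closures in $K\times K$. In particular, no critical point of index $0$ or $1$ of the perturbed energy function lies in $B\cup F\cup S$: no such cord starts or ends at the base point, meets the framing, or meets the knot in its interior. -/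

import Mathlib

open Set Topology
open scoped ContDiff

noncomputable section

/-- Euclidean three-space. -/
abbrev E3 : Type := EuclideanSpace ℝ (Fin 3)

/-- The derivative of a map on the circle `ℝ/ℤ`, taken in the coordinate `x ↦ θ + x` at `θ`. -/
def circleDeriv (g : UnitAddCircle → E3) (θ : UnitAddCircle) : E3 :=
  deriv (fun x : ℝ => g (θ + (x : UnitAddCircle))) 0

/-- Smooth (`C^∞`) maps from the circle `ℝ/ℤ` to `ℝ³`. -/
structure SmoothLoop where
  toFun : UnitAddCircle → E3
  smooth : ContDiff ℝ ∞ (fun x : ℝ => toFun (x : UnitAddCircle))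

/-- The `C^∞` topology: uniform convergence of the derivatives of every order `n ≥ 0`. -/
instance SmoothLoop.instTopologicalSpace : TopologicalSpace SmoothLoop :=
  TopologicalSpace.induced
    (fun g (n : ℕ) => (UniformFun.ofFun (circleDeriv^[n] g.toFun) : UniformFun UnitAddCircle E3))
    inferInstance

/-- A (parametrized, hence oriented) smooth knot in `ℝ³`: a smooth embedding of the circle. -/
structure Knot extends SmoothLoop where
  injective : Function.Injective toFun
  immersion : ∀ θ, circleDeriv toFun θ ≠ 0

namespace Knot

/-- The space of knots carries the `C^∞` topology. -/
instance instTopologicalSpace : TopologicalSpace Knot :=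
  TopologicalSpace.induced Knot.toSmoothLoop inferInstance

/-- The plane through the origin that is normal to the knot at the point with parameter `θ`. -/
def normalPlane (K : Knot) (θ : UnitAddCircle) : Submodule ℝ E3 :=
  (Submodule.span ℝ {circleDeriv K.toFun θ})ᗮ

/-- A framing: a smooth unit normal vector field along the knot. -/
structure Framing (K : Knot) extends SmoothLoop where
  norm_eq_one : ∀ θ, ‖toFun θ‖ = 1
  normal : ∀ θ, toFun θ ∈ K.normalPlane θ

/-- The space of framings of a knot carries the `C^∞` topology. -/
instance Framing.instTopologicalSpace (K : Knot) : TopologicalSpace K.Framing :=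
  TopologicalSpace.induced Framing.toSmoothLoop inferInstance

end Knot

/-- The torus `ℝ/ℤ × ℝ/ℤ`. For a knot `K`, its points are the (linear) cords of `K`: the point
`(s, t)` is the straight segment from `K s` to `K t`. -/
abbrev Torus : Type := UnitAddCircle × UnitAddCircle

namespace Torus

/-- Smooth real functions on the torus. -/
def IsSmooth (h : Torus → ℝ) : Prop :=
  ContDiff ℝ ∞ (fun x : ℝ × ℝ => h ((x.1 : UnitAddCircle), (x.2 : UnitAddCircle)))

/-- `h` in the local coordinates centred at `c`. -/
def inCoords (h : Torus → ℝ) (c : Torus) (x : ℝ × ℝ) : ℝ :=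
  h (c.1 + (x.1 : UnitAddCircle), c.2 + (x.2 : UnitAddCircle))

/-- Critical points. -/
def IsCritical (h : Torus → ℝ) (c : Torus) : Prop :=
  fderiv ℝ (inCoords h c) 0 = 0

/-- The Hessian of `h` at `c`, as a bilinear form in the local coordinates. -/
def hessian (h : Torus → ℝ) (c : Torus) : (ℝ × ℝ) →L[ℝ] (ℝ × ℝ) →L[ℝ] ℝ :=
  fderiv ℝ (fderiv ℝ (inCoords h c)) 0

/-- A smooth function all of whose critical points are nondegenerate. -/
def IsMorse (h : Torus → ℝ) : Prop :=
  IsSmooth h ∧ ∀ c, IsCritical h c → ∀ v, (∀ w, hessian h c v w = 0) → v = 0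

/-- The Morse index of `h` at `c` is `k`: the largest dimension of a subspace on which the Hessian
is negative definite. -/
def HasIndex (h : Torus → ℝ) (c : Torus) (k : ℕ) : Prop :=
  IsGreatest {d : ℕ | ∃ V : Submodule ℝ (ℝ × ℝ), Module.finrank ℝ V = d ∧
    ∀ v ∈ V, v ≠ 0 → hessian h c v v < 0} k

/-- `Crit k h` is the set of critical points of `h` of Morse index `k`. -/
def Crit (k : ℕ) (h : Torus → ℝ) : Set Torus :=
  {c | IsCritical h c ∧ HasIndex h c k}

end Torus

namespace Knot

/-- The energy function `E(s, t) = |K s - K t|² / 2` on the space of cords. -/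
def energy (K : Knot) (c : Torus) : ℝ :=
  (1 / 2 : ℝ) * ‖K.toFun c.1 - K.toFun c.2‖ ^ 2

/-- `f` is a smooth function that vanishes outside `U` (in use, a small neighbourhood of the
diagonal) and turns the energy function into a Morse function `E + f`. Nothing more is asked of `f`,
neither its size nor the number or position of its critical points on the diagonal. -/
structure IsMorsePerturbation (K : Knot) (U : Set Torus) (f : Torus → ℝ) : Prop where
  smooth : Torus.IsSmooth f
  vanishes : ∀ c, c ∉ U → f c = 0
  morse : Torus.IsMorse (K.energy + f)

/-- `S`: the cords that meet the knot in their interior (constant cords have no interior). -/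
def S (K : Knot) : Set Torus :=
  {c | c.1 ≠ c.2 ∧ ∃ u, K.toFun u ∈ openSegment ℝ (K.toFun c.1) (K.toFun c.2)}

/-- `F^s`: the cords that intersect the framing at their startpoint, i.e. the orthogonal projection
of the cord to the normal plane at the startpoint is a positive multiple of the framing vector. -/
def Fs (K : Knot) (ν : K.Framing) : Set Torus :=
  {c | ∃ α : ℝ, 0 < α ∧
    (K.normalPlane c.1).starProjection (K.toFun c.2 - K.toFun c.1) = α • ν.toFun c.1}

/-- `F^e`: the cords that intersect the framing at their endpoint. -/
def Fe (K : Knot) (ν : K.Framing) : Set Torus :=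
  {c | ∃ α : ℝ, 0 < α ∧
    (K.normalPlane c.2).starProjection (K.toFun c.1 - K.toFun c.2) = α • ν.toFun c.2}

/-- `F`: the cords that intersect the framing. -/
def F (K : Knot) (ν : K.Framing) : Set Torus := K.Fs ν ∪ K.Fe ν

/-- `B`: the cords that start or end at the base point, the point of the knot with parameter `p`. -/
def B (p : UnitAddCircle) : Set Torus := {c | c.1 = p ∨ c.2 = p}

end Knot

end

noncomputable section

open Filter

/-! A generic knot is taken to have nowhere vanishing curvature and no binormal chord (a chord
orthogonal to the knot at both ends) that meets the knot in its interior. Both conditions are open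
by compactness of the circle, once short chords are controlled uniformly in the loop
(`eventually_short_chord`).

Density is a dimension count. A loop is perturbed by trigonometric polynomials with coefficients in
`E3`. For each bad configuration the coefficients solve an invertible linear system, so the bad
coefficients lie in finitely many locally Lipschitz images of sets of dimension at most 5 in a space
of dimension 6 (curvature), or at most 14 in a space of dimension 15 (binormal chords). Hausdorff
dimension then shows that good coefficients are dense (`dimH_solutions_le`, `exists_perturb_mem`).

For a generic knot every sufficiently short cord is regular: no three nearby points are collinear,
so it avoids the closure of `S`, and its normal projection has a nonzero direction, which tends to
the curvature vector on the diagonal. A critical cord of `E + f` is either short, or lies where `E +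
f` agrees with `E`; in the latter case it is binormal, hence regular as well
(`exists_nhds_isRegularCord`).

A Morse function on the torus has finitely many critical points. The base point therefore has to
avoid finitely many parameters. At a regular cord, the closure of `F` is avoided as soon as the
framing misses one prescribed unit vector at each end (`notMem_closure_Fs`). Finitely many such
conditions are open, and they are dense because a framing can be rotated by a small constant angle.
The argument treats critical points of all indices alike. -/

theorem isOpenQuotientMap_coe_circle : IsOpenQuotientMap ((↑) : ℝ → UnitAddCircle) :=
  QuotientAddGroup.isOpenQuotientMap_mk

theorem circleDeriv_coe (g : UnitAddCircle → E3) (x : ℝ) :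
    circleDeriv g x = deriv (fun y : ℝ => g y) x := by
  have h := deriv_comp_const_add (fun y : ℝ => g (y : UnitAddCircle)) x 0
  simpa [circleDeriv] using h

/-! ### Jets of loops, the `C^∞` topology and short chords -/

namespace SmoothLoop

/-- The `n`-th derivative of a loop. -/
def jet (n : ℕ) (g : SmoothLoop) : UnitAddCircle → E3 := circleDeriv^[n] g.toFun

theorem jet_zero (g : SmoothLoop) : g.jet 0 = g.toFun := rfl

theorem jet_succ (n : ℕ) (g : SmoothLoop) : g.jet (n + 1) = circleDeriv (g.jet n) :=
  Function.iterate_succ_apply' _ _ _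

theorem jet_succ_coe (n : ℕ) (g : SmoothLoop) :
    (fun x : ℝ => g.jet (n + 1) x) = deriv (fun x : ℝ => g.jet n x) := by
  ext1 x
  rw [jet_succ, circleDeriv_coe]

theorem contDiff_jet (n : ℕ) (g : SmoothLoop) : ContDiff ℝ ∞ (fun x : ℝ => g.jet n x) := by
  induction n with
  | zero => exact g.smooth
  | succ n ih =>
    rw [jet_succ_coe]
    exact (contDiff_infty_iff_deriv.1 ih).2

theorem hasDerivAt_jet (n : ℕ) (g : SmoothLoop) (x : ℝ) :
    HasDerivAt (fun x : ℝ => g.jet n x) (g.jet (n + 1) x) x := by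
  have h := ((contDiff_infty_iff_deriv.1 (g.contDiff_jet n)).1 x).hasDerivAt
  rwa [← jet_succ_coe] at h

theorem hasDerivAt (g : SmoothLoop) (x : ℝ) :
    HasDerivAt (fun x : ℝ => g.toFun x) (g.jet 1 x) x :=
  g.hasDerivAt_jet 0 x

theorem continuous_jet (n : ℕ) (g : SmoothLoop) : Continuous (g.jet n) :=
  isOpenQuotientMap_coe_circle.isQuotientMap.continuous_iff.2 (g.contDiff_jet n).continuous

theorem tendstoUniformly_jet (n : ℕ) (g : SmoothLoop) :
    TendstoUniformly (fun h : SmoothLoop => h.jet n) (g.jet n) (𝓝 g) := by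
  have h1 : Continuous (fun (h : SmoothLoop) (n : ℕ) =>
      (UniformFun.ofFun (h.jet n) : UniformFun UnitAddCircle E3)) := continuous_induced_dom
  have h2 := ((continuous_apply n).comp h1).tendsto g
  exact UniformFun.tendsto_iff_tendstoUniformly.1 h2

/-- Uniform convergence to a continuous limit gives joint continuity in loop and parameter; all the
compactness arguments for openness rest on this. -/
theorem continuous_jet_uncurry (n : ℕ) :
    Continuous fun q : SmoothLoop × UnitAddCircle => q.1.jet n q.2 := by
  rw [continuous_iff_continuousAt]
  rintro ⟨g, θ⟩
  rw [ContinuousAt, Metric.tendsto_nhds]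
  intro ε hε
  have h1 := Metric.tendstoUniformly_iff.1 (g.tendstoUniformly_jet n) (ε / 2) (half_pos hε)
  have h2 := Metric.tendsto_nhds.1 ((g.continuous_jet n).tendsto θ) (ε / 2) (half_pos hε)
  rw [nhds_prod_eq]
  filter_upwards [h1.prod_mk h2] with q hq
  calc dist (q.1.jet n q.2) (g.jet n θ)
      ≤ dist (q.1.jet n q.2) (g.jet n q.2) + dist (g.jet n q.2) (g.jet n θ) :=
        dist_triangle _ _ _
    _ < ε / 2 + ε / 2 := by
        refine add_lt_add ?_ hq.2
        rw [dist_comm]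
        exact hq.1 q.2
    _ = ε := add_halves ε

theorem continuous_jet_comp {X : Type*} [TopologicalSpace X] (n : ℕ) {g : X → SmoothLoop}
    {θ : X → UnitAddCircle} (hg : Continuous g) (hθ : Continuous θ) :
    Continuous fun x => (g x).jet n (θ x) :=
  (continuous_jet_uncurry n).comp (hg.prodMk hθ)

theorem continuous_toFun_comp {X : Type*} [TopologicalSpace X] {g : X → SmoothLoop}
    {θ : X → UnitAddCircle} (hg : Continuous g) (hθ : Continuous θ) :
    Continuous fun x => (g x).toFun (θ x) :=
  continuous_jet_comp 0 hg hθ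

theorem continuous_toFun (g : SmoothLoop) : Continuous g.toFun := g.continuous_jet 0

/-- A short chord of an immersed loop is almost tangent to it, locally uniformly in the loop. -/
theorem eventually_short_chord {g₀ : SmoothLoop} {s₀ : UnitAddCircle} (h₀ : g₀.jet 1 s₀ ≠ 0) :
    ∀ᶠ q : SmoothLoop × Torus in 𝓝 (g₀, s₀, s₀), q.2.1 ≠ q.2.2 →
      q.1.toFun q.2.1 ≠ q.1.toFun q.2.2 ∧
      0 < ‖q.1.jet 1 q.2.1‖ * ‖q.1.toFun q.2.2 - q.1.toFun q.2.1‖ ∧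
      ‖q.1.jet 1 q.2.1‖ * ‖q.1.toFun q.2.2 - q.1.toFun q.2.1‖ ≤
        2 * |inner ℝ (q.1.jet 1 q.2.1) (q.1.toFun q.2.2 - q.1.toFun q.2.1)| := by
  obtain ⟨x₀, rfl⟩ := isOpenQuotientMap_coe_circle.surjective s₀
  have hmap := (IsOpenQuotientMap.id (X := SmoothLoop)).prodMap
    (isOpenQuotientMap_coe_circle.prodMap isOpenQuotientMap_coe_circle) |>.map_nhds_eq (g₀, x₀, x₀)
  simp only [Prod.map_apply, id] at hmap
  rw [← hmap, eventually_map]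
  set m := ‖g₀.jet 1 x₀‖ with hm
  have hm0 : 0 < m := norm_pos_iff.2 h₀
  have hc : Continuous fun q : SmoothLoop × ℝ => q.1.jet 1 (q.2 : UnitAddCircle) :=
    continuous_jet_comp 1 continuous_fst
      (isOpenQuotientMap_coe_circle.continuous.comp continuous_snd)
  -- With tolerance `m / 8` the velocity oscillates by at most `m / 4` and `‖v‖ > 7 * m / 8`. The
  -- error `e` of the linear approximation then satisfies `3 * ‖e‖ ≤ |y - x| * ‖v‖`, which is
  -- exactly what the factor 2 in the conclusion (an angle of at most 60° with the tangent line)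
  -- requires.
  have h1 := Metric.tendsto_nhds.1 (hc.tendsto (g₀, x₀)) (m / 8) (by positivity)
  rw [nhds_prod_eq, eventually_prod_iff] at h1
  obtain ⟨pa, hpa, pb, hpb, hp⟩ := h1
  obtain ⟨r, hr, hball⟩ := Metric.eventually_nhds_iff_ball.1 hpb
  have hb : ∀ᶠ x in 𝓝 x₀, x ∈ Metric.ball x₀ r := Metric.ball_mem_nhds x₀ hr
  rw [nhds_prod_eq, nhds_prod_eq]
  filter_upwards [hpa.prod_mk (hb.prod_mk hb)]
  rintro ⟨g, x, y⟩ ⟨hg, hx, hy⟩ hne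
  simp only [Prod.map_apply, id] at hg hx hy hne ⊢
  have hd : ∀ z ∈ Metric.ball x₀ r, ‖g.jet 1 z - g₀.jet 1 x₀‖ < m / 8 := fun z hz => by
    simpa [dist_eq_norm] using hp hg (hball z hz)
  have hxy : x ≠ y := fun h => hne (by rw [h])
  set v := g.jet 1 (x : UnitAddCircle) with hv
  have hvm : 7 * m / 8 < ‖v‖ := by
    have h1 := hd x hx
    have h2 := norm_sub_norm_le (g₀.jet 1 (x₀ : UnitAddCircle)) v
    rw [norm_sub_rev] at h2
    linarith
  -- Mean value inequality for the loop minus its linear part at `x`.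
  have hmv := Convex.norm_image_sub_le_of_norm_hasDerivWithin_le
    (f := fun z : ℝ => g.toFun z - z • v) (f' := fun z : ℝ => g.jet 1 z - v) (C := m / 4)
    (fun z _ => by
      have := (g.hasDerivAt z).sub ((hasDerivAt_id' z).smul_const v)
      rw [one_smul] at this
      exact this.hasDerivWithinAt)
    (fun z hz => by
      have h1 := hd z hz
      have h2 := hd x hx
      have h3 := norm_sub_le_norm_sub_add_norm_sub (g.jet 1 (z : UnitAddCircle))
        (g₀.jet 1 (x₀ : UnitAddCircle)) v
      rw [norm_sub_rev (g₀.jet 1 (x₀ : UnitAddCircle)) v] at h3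
      linarith) (convex_ball x₀ r) hx hy
  set d := g.toFun (y : UnitAddCircle) - g.toFun (x : UnitAddCircle) with hdd
  set e := d - (y - x) • v with he
  have hmv' : ‖e‖ ≤ m / 4 * |y - x| := by
    have h1 : e = (g.toFun y - y • v) - (g.toFun x - x • v) := by
      rw [he, hdd, sub_smul]; abel
    rw [h1]
    exact hmv
  have hyx : 0 < |y - x| := abs_pos.2 (sub_ne_zero.2 hxy.symm)
  have hde : d = (y - x) • v + e := by simp [he]
  have hin : inner ℝ v d = (y - x) * ‖v‖ ^ 2 + inner ℝ v e := by
    rw [hde, inner_add_right, inner_smul_right, real_inner_self_eq_norm_sq]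
  have hcs : |inner ℝ v e| ≤ ‖v‖ * ‖e‖ := abs_real_inner_le_norm v e
  have hlow : |y - x| * ‖v‖ ^ 2 - ‖v‖ * ‖e‖ ≤ |inner ℝ v d| := by
    have h1 := abs_sub_abs_le_abs_sub ((y - x) * ‖v‖ ^ 2) (-inner ℝ v e)
    rw [abs_neg, sub_neg_eq_add, ← hin, abs_mul, abs_of_nonneg (sq_nonneg ‖v‖)] at h1
    linarith
  have hup : ‖d‖ ≤ |y - x| * ‖v‖ + ‖e‖ := by
    rw [hde]
    refine (norm_add_le _ _).trans ?_
    rw [norm_smul, Real.norm_eq_abs]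
  have hvpos : 0 < ‖v‖ := by linarith
  have hlow' : 0 < |inner ℝ v d| := by
    have : ‖v‖ * ‖e‖ < |y - x| * ‖v‖ ^ 2 := by
      have : ‖e‖ < |y - x| * ‖v‖ := by nlinarith
      nlinarith
    linarith
  have hd0 : d ≠ 0 := by
    rintro h
    rw [h, inner_zero_right, abs_zero] at hlow'
    exact lt_irrefl _ hlow'
  refine ⟨fun h => hd0 (by rw [hdd, h, sub_self]), mul_pos hvpos (norm_pos_iff.2 hd0), ?_⟩
  have h3 : 3 * ‖e‖ ≤ |y - x| * ‖v‖ := by nlinarith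
  nlinarith

/-- Near an immersed loop, short chords are not orthogonal to the loop at their first endpoint. -/
theorem eventually_inner_ne_zero {g₀ : SmoothLoop} {s₀ : UnitAddCircle} (h₀ : g₀.jet 1 s₀ ≠ 0) :
    ∀ᶠ q : SmoothLoop × Torus in 𝓝 (g₀, s₀, s₀), q.2.1 ≠ q.2.2 →
      inner ℝ (q.1.jet 1 q.2.1) (q.1.toFun q.2.2 - q.1.toFun q.2.1) ≠ 0 := by
  filter_upwards [eventually_short_chord h₀] with q hq hne h
  obtain ⟨-, h1, h2⟩ := hq hne
  rw [h] at h2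
  simp at h2
  linarith

end SmoothLoop

/-! ### Openness of embeddedness and of clear binormal chords -/

/-- Injectively immersed loops. -/
def embeddedLoops : Set SmoothLoop :=
  {g | Function.Injective g.toFun ∧ ∀ θ, g.jet 1 θ ≠ 0}

/-- Compactness of the circle and the torus reduces this to a local check. Off the diagonal,
distinctness of values is an open condition; at the diagonal it comes from the short chord estimate,
which is uniform in the loop. -/
theorem isOpen_embeddedLoops : IsOpen embeddedLoops := by
  rw [isOpen_iff_eventually]
  rintro g₀ ⟨hinj, himm⟩
  have h1 : ∀ᶠ g in 𝓝 g₀, ∀ θ ∈ (univ : Set UnitAddCircle), g.jet 1 θ ≠ 0 :=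
    isCompact_univ.eventually_forall_of_forall_eventually fun θ _ =>
      ((SmoothLoop.continuous_jet_uncurry 1).tendsto (g₀, θ)).eventually_ne (himm θ)
  have h2 : ∀ᶠ g in 𝓝 g₀, ∀ c ∈ (univ : Set Torus), c.1 ≠ c.2 → g.toFun c.1 ≠ g.toFun c.2 := by
    refine isCompact_univ.eventually_forall_of_forall_eventually ?_
    rintro ⟨s, t⟩ -
    by_cases hst : s = t
    · subst hst
      filter_upwards [SmoothLoop.eventually_short_chord (himm s)] with q hq hne
      exact (hq hne).1
    · have hc1 : Continuous fun q : SmoothLoop × Torus => q.1.toFun q.2.1 :=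
        SmoothLoop.continuous_toFun_comp continuous_fst continuous_snd.fst
      have hc2 : Continuous fun q : SmoothLoop × Torus => q.1.toFun q.2.2 :=
        SmoothLoop.continuous_toFun_comp continuous_fst continuous_snd.snd
      filter_upwards [(isOpen_ne_fun hc1 hc2).mem_nhds
        (show (g₀, s, t) ∈ {q : SmoothLoop × Torus | q.1.toFun q.2.1 ≠ q.1.toFun q.2.2} from
          fun h => hst (hinj h))] with q hq _
      exact hq
  filter_upwards [h1, h2] with g hg1 hg2
  exact ⟨fun s t hst => by_contra fun hne => hg2 (s, t) (mem_univ _) hne hst,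
    fun θ => hg1 θ (mem_univ _)⟩

theorem exists_pos_smul_of_mem_openSegment {x y z : E3} (h : z ∈ openSegment ℝ x y) :
    ∃ r : ℝ, 0 < r ∧ z - x = r • (y - x) := by
  obtain ⟨a, b, ha, hb, hab, rfl⟩ := h
  refine ⟨b, hb, ?_⟩
  rw [← eq_sub_iff_add_eq] at hab
  subst hab
  module

/-- Loops without binormal chords that meet the loop in their interior. -/
def clearLoops : Set SmoothLoop :=
  {g | ∀ s t u, s ≠ t → inner ℝ (g.jet 1 s) (g.toFun t - g.toFun s) = 0 →
    inner ℝ (g.jet 1 t) (g.toFun s - g.toFun t) = 0 →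
      g.toFun u ∉ openSegment ℝ (g.toFun s) (g.toFun t)}

/-- If a point of the loop near the startpoint lay on the chord, the short chord to it would be
almost tangent to the loop, yet parallel to a chord almost orthogonal to the loop. -/
theorem eventually_notMem_openSegment_left {g₀ : SmoothLoop} (h₀ : g₀ ∈ embeddedLoops)
    {s t : UnitAddCircle} (hst : s ≠ t)
    (hs : inner ℝ (g₀.jet 1 s) (g₀.toFun t - g₀.toFun s) = 0) :
    ∀ᶠ q : SmoothLoop × Torus × UnitAddCircle in 𝓝 (g₀, (s, t), s),
      q.1.toFun q.2.2 ∉ openSegment ℝ (q.1.toFun q.2.1.1) (q.1.toFun q.2.1.2) := by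
  have hc : Continuous fun q : SmoothLoop × Torus × UnitAddCircle => (q.1, q.2.1.1, q.2.2) := by
    fun_prop
  have hd : Continuous fun q : SmoothLoop × Torus × UnitAddCircle =>
      q.1.toFun q.2.1.2 - q.1.toFun q.2.1.1 :=
    (SmoothLoop.continuous_toFun_comp (by fun_prop) (by fun_prop)).sub
      (SmoothLoop.continuous_toFun_comp (by fun_prop) (by fun_prop))
  have hv : Continuous fun q : SmoothLoop × Torus × UnitAddCircle => q.1.jet 1 q.2.1.1 :=
    SmoothLoop.continuous_jet_comp 1 (by fun_prop) (by fun_prop)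
  have hd0 : g₀.toFun t - g₀.toFun s ≠ 0 := sub_ne_zero.2 fun h => hst (h₀.1 h).symm
  have h1 := hc.tendsto (g₀, (s, t), s) |>.eventually (SmoothLoop.eventually_short_chord (h₀.2 s))
  have h2 : ∀ᶠ q : SmoothLoop × Torus × UnitAddCircle in 𝓝 (g₀, (s, t), s),
      2 * |inner ℝ (q.1.jet 1 q.2.1.1) (q.1.toFun q.2.1.2 - q.1.toFun q.2.1.1)| <
        ‖q.1.jet 1 q.2.1.1‖ * ‖q.1.toFun q.2.1.2 - q.1.toFun q.2.1.1‖ := by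
    refine (isOpen_lt ((hv.inner hd).abs.const_mul 2) (hv.norm.mul hd.norm)).mem_nhds ?_
    simp only [mem_ofPred_eq, hs, abs_zero, mul_zero]
    exact mul_pos (norm_pos_iff.2 (h₀.2 s)) (norm_pos_iff.2 hd0)
  have h3 : ∀ᶠ q : SmoothLoop × Torus × UnitAddCircle in 𝓝 (g₀, (s, t), s),
      q.1.toFun q.2.1.2 - q.1.toFun q.2.1.1 ≠ 0 := (hd.tendsto _).eventually_ne hd0
  filter_upwards [h1, h2, h3] with q hq1 hq2 hq3 hmem
  obtain ⟨r, hr, hrd⟩ := exists_pos_smul_of_mem_openSegment hmem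
  have hne : q.2.1.1 ≠ q.2.2 := by
    intro h
    rw [← h, sub_self, eq_comm, smul_eq_zero] at hrd
    exact hrd.elim hr.ne' hq3
  have h4 := (hq1 hne).2.2
  simp only [hrd, norm_smul, inner_smul_right, abs_mul, Real.norm_eq_abs, abs_of_pos hr] at h4
  nlinarith

/-- The open segment alone gives no open condition. Away from the endpoints it can be replaced by
the closed segment, whose avoidance is a strict triangle inequality; at the endpoints orthogonality
takes over. -/
theorem eventually_notMem_openSegment {g₀ : SmoothLoop} (h₀ : g₀ ∈ embeddedLoops)
    {s t u : UnitAddCircle} (hst : s ≠ t)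
    (hs : inner ℝ (g₀.jet 1 s) (g₀.toFun t - g₀.toFun s) = 0)
    (ht : inner ℝ (g₀.jet 1 t) (g₀.toFun s - g₀.toFun t) = 0)
    (hu : g₀.toFun u ∉ openSegment ℝ (g₀.toFun s) (g₀.toFun t)) :
    ∀ᶠ q : SmoothLoop × Torus × UnitAddCircle in 𝓝 (g₀, (s, t), u),
      q.1.toFun q.2.2 ∉ openSegment ℝ (q.1.toFun q.2.1.1) (q.1.toFun q.2.1.2) := by
  by_cases hus : u = s
  · subst hus
    exact eventually_notMem_openSegment_left h₀ hst hs
  by_cases hut : u = t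
  · subst hut
    have hc : Continuous fun q : SmoothLoop × Torus × UnitAddCircle =>
        (q.1, (q.2.1.2, q.2.1.1), q.2.2) := by fun_prop
    filter_upwards [hc.tendsto (g₀, (s, u), u) |>.eventually
      (eventually_notMem_openSegment_left h₀ hst.symm ht)] with q hq
    rwa [openSegment_symm]
  have hs' : Continuous fun q : SmoothLoop × Torus × UnitAddCircle => q.1.toFun q.2.1.1 :=
    SmoothLoop.continuous_toFun_comp (by fun_prop) (by fun_prop)
  have ht' : Continuous fun q : SmoothLoop × Torus × UnitAddCircle => q.1.toFun q.2.1.2 :=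
    SmoothLoop.continuous_toFun_comp (by fun_prop) (by fun_prop)
  have hu' : Continuous fun q : SmoothLoop × Torus × UnitAddCircle => q.1.toFun q.2.2 :=
    SmoothLoop.continuous_toFun_comp (by fun_prop) (by fun_prop)
  have hseg : g₀.toFun u ∉ segment ℝ (g₀.toFun s) (g₀.toFun t) := fun h =>
    hu (mem_openSegment_of_ne_left_right (fun h => hus (h₀.1 h).symm)
      (fun h => hut (h₀.1 h).symm) h)
  rw [mem_segment_iff_wbtw, ← dist_add_dist_eq_iff] at hseg
  filter_upwards [(isOpen_ne_fun ((hs'.dist hu').add (hu'.dist ht')) (hs'.dist ht')).mem_nhds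
    hseg] with q hq hmem
  exact hq (dist_add_dist_eq_iff.2 (mem_segment_iff_wbtw.1 (openSegment_subset_segment _ _ _ hmem)))

/-- Compactness in the triple `((s, t), u)`. At `s = t` short chords fail to be orthogonal;
elsewhere either an orthogonality relation fails, which is stable, or the chord is binormal and
stably clear. -/
theorem isOpen_embeddedLoops_inter_clearLoops : IsOpen (embeddedLoops ∩ clearLoops) := by
  rw [isOpen_iff_eventually]
  rintro g₀ ⟨h₀, hclear⟩
  have h1 : ∀ᶠ g in 𝓝 g₀, ∀ c ∈ (univ : Set (Torus × UnitAddCircle)), c.1.1 ≠ c.1.2 →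
      inner ℝ (g.jet 1 c.1.1) (g.toFun c.1.2 - g.toFun c.1.1) = 0 →
      inner ℝ (g.jet 1 c.1.2) (g.toFun c.1.1 - g.toFun c.1.2) = 0 →
      g.toFun c.2 ∉ openSegment ℝ (g.toFun c.1.1) (g.toFun c.1.2) := by
    refine isCompact_univ.eventually_forall_of_forall_eventually ?_
    rintro ⟨⟨s, t⟩, u⟩ -
    have hs' : Continuous fun q : SmoothLoop × Torus × UnitAddCircle => q.1.toFun q.2.1.1 :=
      SmoothLoop.continuous_toFun_comp (by fun_prop) (by fun_prop)
    have ht' : Continuous fun q : SmoothLoop × Torus × UnitAddCircle => q.1.toFun q.2.1.2 :=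
      SmoothLoop.continuous_toFun_comp (by fun_prop) (by fun_prop)
    have hvs : Continuous fun q : SmoothLoop × Torus × UnitAddCircle => q.1.jet 1 q.2.1.1 :=
      SmoothLoop.continuous_jet_comp 1 (by fun_prop) (by fun_prop)
    have hvt : Continuous fun q : SmoothLoop × Torus × UnitAddCircle => q.1.jet 1 q.2.1.2 :=
      SmoothLoop.continuous_jet_comp 1 (by fun_prop) (by fun_prop)
    by_cases hst : s = t
    · subst hst
      have hc : Continuous fun q : SmoothLoop × Torus × UnitAddCircle => (q.1, q.2.1) := by
        fun_prop
      filter_upwards [hc.tendsto (g₀, (s, s), u) |>.eventually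
        (SmoothLoop.eventually_inner_ne_zero (h₀.2 s))] with q hq hne hin
      exact absurd hin (hq hne)
    by_cases hs : inner ℝ (g₀.jet 1 s) (g₀.toFun t - g₀.toFun s) = 0
    · by_cases ht : inner ℝ (g₀.jet 1 t) (g₀.toFun s - g₀.toFun t) = 0
      · filter_upwards [eventually_notMem_openSegment h₀ hst hs ht
          (hclear s t u hst hs ht)] with q hq _ _ _
        exact hq
      · filter_upwards [((hvt.inner (hs'.sub ht')).tendsto (g₀, (s, t), u)).eventually_ne ht]
          with q hq _ _ hin
        exact absurd hin hq
    · filter_upwards [((hvs.inner (ht'.sub hs')).tendsto (g₀, (s, t), u)).eventually_ne hs]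
        with q hq _ hin
      exact absurd hin hq
  filter_upwards [isOpen_embeddedLoops.mem_nhds h₀, h1] with g hg1 hg2
  exact ⟨hg1, fun s t u => hg2 ((s, t), u) (mem_univ _)⟩

/-! ### Curvature and the local geometry of short chords -/

/-- The part of `w` orthogonal to `v`, scaled by `‖v‖²`. -/
def normalPart (v w : E3) : E3 := ‖v‖ ^ 2 • w - inner ℝ v w • v

theorem normalPart_zero_right (v : E3) : normalPart v 0 = 0 := by simp [normalPart]

theorem inner_normalPart_self (v w : E3) : inner ℝ v (normalPart v w) = 0 := by
  rw [normalPart, inner_sub_right, inner_smul_right, inner_smul_right, real_inner_self_eq_norm_sq]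
  ring

theorem inner_normalPart_comm (v w w' : E3) :
    inner ℝ w (normalPart v w') = inner ℝ (normalPart v w) w' := by
  simp only [normalPart, inner_sub_right, inner_sub_left, inner_smul_right, inner_smul_left,
    real_inner_comm v w]
  simp
  ring

theorem normalPart_of_inner_eq_zero {v w : E3} (h : inner ℝ v w = 0) :
    normalPart v w = ‖v‖ ^ 2 • w := by
  simp [normalPart, h]

theorem continuous_normalPart {X : Type*} [TopologicalSpace X] {v w : X → E3}
    (hv : Continuous v) (hw : Continuous w) : Continuous fun x => normalPart (v x) (w x) := by
  have h : Continuous fun x => inner ℝ (v x) (w x) := hv.inner hw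
  unfold normalPart
  fun_prop

theorem smul_starProjection_orthogonal {v : E3} (hv : v ≠ 0) (w : E3) :
    ‖v‖ ^ 2 • (Submodule.span ℝ {v})ᗮ.starProjection w = normalPart v w := by
  rw [Submodule.starProjection_orthogonal_val, Submodule.starProjection_singleton, normalPart,
    smul_sub, smul_smul]
  congr 2
  have : ‖v‖ ^ 2 ≠ 0 := by simpa using hv
  simp only [RCLike.ofReal_real_eq_id, id]
  field_simp

namespace SmoothLoop

/-- The normal part of the second derivative, a nonzero multiple of the curvature vector. -/
def curv (g : SmoothLoop) (θ : UnitAddCircle) : E3 := normalPart (g.jet 1 θ) (g.jet 2 θ)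

theorem continuous_curv_uncurry :
    Continuous fun q : SmoothLoop × UnitAddCircle => q.1.curv q.2 :=
  continuous_normalPart (continuous_jet_uncurry 1) (continuous_jet_uncurry 2)

end SmoothLoop

/-- Loops with nowhere vanishing curvature. -/
def curvedLoops : Set SmoothLoop := {g | ∀ θ, g.curv θ ≠ 0}

theorem isOpen_curvedLoops : IsOpen curvedLoops := by
  rw [isOpen_iff_eventually]
  intro g₀ h₀
  have h1 : ∀ᶠ g in 𝓝 g₀, ∀ θ ∈ (univ : Set UnitAddCircle), g.curv θ ≠ 0 :=
    isCompact_univ.eventually_forall_of_forall_eventually fun θ _ =>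
      (SmoothLoop.continuous_curv_uncurry.tendsto (g₀, θ)).eventually_ne (h₀ θ)
  filter_upwards [h1] with g hg θ
  exact hg θ (mem_univ _)

theorem exists_mem_hasDerivAt_eq_zero {I : Set ℝ} (hI : I.OrdConnected) {f f' : ℝ → ℝ}
    (hf : ∀ x, HasDerivAt f (f' x) x) {a b : ℝ} (ha : a ∈ I) (hb : b ∈ I) (hab : a < b)
    (hfab : f a = f b) : ∃ c ∈ Ioo a b, c ∈ I ∧ f' c = 0 := by
  obtain ⟨c, hc, h⟩ := exists_hasDerivAt_eq_zero hab
    (fun x _ => (hf x).continuousAt.continuousWithinAt) hfab (fun x _ => hf x)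
  exact ⟨c, hc, hI.out ha hb (Ioo_subset_Icc_self hc), h⟩

/-- Rolle's theorem on both gaps, and once more between the two zeros found. -/
theorem exists_deriv_eq_zero_of_lt {I : Set ℝ} (hI : I.OrdConnected) {f f' f'' : ℝ → ℝ}
    (hf : ∀ x, HasDerivAt f (f' x) x) (hf' : ∀ x, HasDerivAt f' (f'' x) x) {a b c : ℝ}
    (ha : a ∈ I) (hb : b ∈ I) (hc : c ∈ I) (hab : a < b) (hbc : b < c) (h1 : f a = f b)
    (h2 : f b = f c) : ∃ x ∈ I, ∃ y ∈ I, f' x = 0 ∧ f'' y = 0 := by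
  obtain ⟨p, hp, hpI, hp0⟩ := exists_mem_hasDerivAt_eq_zero hI hf ha hb hab h1
  obtain ⟨q, hq, hqI, hq0⟩ := exists_mem_hasDerivAt_eq_zero hI hf hb hc hbc h2
  obtain ⟨r, -, hrI, hr0⟩ := exists_mem_hasDerivAt_eq_zero hI hf' hpI hqI (hp.2.trans hq.1)
    (hp0.trans hq0.symm)
  exact ⟨p, hpI, r, hrI, hp0, hr0⟩

theorem exists_deriv_eq_zero_of_ne {I : Set ℝ} (hI : I.OrdConnected) {f f' f'' : ℝ → ℝ}
    (hf : ∀ x, HasDerivAt f (f' x) x) (hf' : ∀ x, HasDerivAt f' (f'' x) x) {a b c : ℝ}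
    (ha : a ∈ I) (hb : b ∈ I) (hc : c ∈ I) (hab : a ≠ b) (hbc : b ≠ c) (hac : a ≠ c)
    (h1 : f a = f b) (h2 : f b = f c) : ∃ x ∈ I, ∃ y ∈ I, f' x = 0 ∧ f'' y = 0 := by
  have key := fun {a b c : ℝ} => exists_deriv_eq_zero_of_lt hI hf hf' (a := a) (b := b) (c := c)
  rcases lt_or_gt_of_ne hab with hab | hab <;> rcases lt_or_gt_of_ne hbc with hbc | hbc
  · exact key ha hb hc hab hbc h1 h2
  · rcases lt_or_gt_of_ne hac with hac | hac
    · exact key ha hc hb hac hbc (h1.trans h2) h2.symm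
    · exact key hc ha hb hac hab (h1.trans h2).symm h1
  · rcases lt_or_gt_of_ne hac with hac | hac
    · exact key hb ha hc hab hac h1.symm (h1.trans h2)
    · exact key hb hc ha hbc hac h2 (h1.trans h2).symm
  · exact key hc hb ha hbc hab h2.symm h1.symm

theorem SmoothLoop.hasDerivAt_inner_jet (g : SmoothLoop) (n : ℕ) (w : E3) (x : ℝ) :
    HasDerivAt (fun x : ℝ => inner ℝ w (g.jet n x)) (inner ℝ w (g.jet (n + 1) x)) x := by
  simpa using (hasDerivAt_const x w).inner ℝ (g.hasDerivAt_jet n x)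

theorem eventually_nhds_ordConnected {p : ℝ → Prop} {x₀ : ℝ} (h : ∀ᶠ x in 𝓝 x₀, p x) :
    ∃ I ∈ 𝓝 x₀, I.OrdConnected ∧ ∀ x ∈ I, p x := by
  obtain ⟨r, hr, hball⟩ := Metric.eventually_nhds_iff_ball.1 h
  exact ⟨_, Metric.ball_mem_nhds x₀ hr, (convex_ball x₀ r).ordConnected, hball⟩

theorem isOpenQuotientMap_coe_torus :
    IsOpenQuotientMap (Prod.map (↑) (↑) : ℝ × ℝ → Torus) :=
  isOpenQuotientMap_coe_circle.prodMap isOpenQuotientMap_coe_circle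

/-- Where the curvature does not vanish, short chords point in the direction of the curvature
vector. -/
theorem SmoothLoop.eventually_inner_normalPart_pos (g : SmoothLoop) {s₀ : UnitAddCircle} {w : E3}
    (hw : 0 < inner ℝ w (g.curv s₀)) :
    ∀ᶠ c : Torus in 𝓝 (s₀, s₀), c.1 ≠ c.2 →
      0 < inner ℝ w (normalPart (g.jet 1 c.1) (g.toFun c.2 - g.toFun c.1)) := by
  obtain ⟨x₀, rfl⟩ := isOpenQuotientMap_coe_circle.surjective s₀
  have hmap := isOpenQuotientMap_coe_torus.map_nhds_eq (x₀, x₀)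
  simp only [Prod.map_apply] at hmap
  rw [← hmap, eventually_map]
  have hcoe := isOpenQuotientMap_coe_circle.continuous
  have hc : Continuous fun q : ℝ × ℝ =>
      inner ℝ (normalPart (g.jet 1 (q.1 : UnitAddCircle)) w) (g.jet 2 (q.2 : UnitAddCircle)) :=
    (continuous_normalPart ((g.continuous_jet 1).comp (hcoe.comp continuous_fst))
      continuous_const).inner ((g.continuous_jet 2).comp (hcoe.comp continuous_snd))
  have h1 : ∀ᶠ q in 𝓝 (x₀, x₀), 0 < inner ℝ (normalPart (g.jet 1 (q.1 : UnitAddCircle)) w)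
      (g.jet 2 (q.2 : UnitAddCircle)) := by
    refine (isOpen_lt continuous_const hc).mem_nhds ?_
    rw [curv, inner_normalPart_comm] at hw
    exact hw
  rw [nhds_prod_eq, eventually_prod_self_iff'] at h1
  obtain ⟨V, hV, hpos⟩ := h1
  obtain ⟨I, hI, hconn, hIV⟩ := eventually_nhds_ordConnected (p := (· ∈ V)) hV
  filter_upwards [prod_mem_nhds hI hI]
  rintro ⟨x, y⟩ ⟨hx, hy⟩ hne
  simp only [Prod.map_apply] at hx hy hne ⊢
  have hxy : x ≠ y := fun h => hne (by rw [h])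
  rw [inner_normalPart_comm, inner_sub_right]
  -- Pairing the loop with `v` gives a function with zero derivative at `x` and positive second
  -- derivative on `I`. Two mean value steps show that it is larger at `y` than at `x`, on either
  -- side of `x`.
  set v := normalPart (g.jet 1 (x : UnitAddCircle)) w with hv
  have hf := g.hasDerivAt_inner_jet 0 v
  have hf' := g.hasDerivAt_inner_jet 1 v
  have h0 : inner ℝ v (g.jet 1 (x : UnitAddCircle)) = 0 := by
    rw [real_inner_comm, hv, inner_normalPart_self]
  have hp : ∀ z ∈ I, 0 < inner ℝ v (g.jet 2 (z : UnitAddCircle)) := fun z hz =>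
    hpos x (hIV x hx) z (hIV z hz)
  rcases lt_or_gt_of_ne hxy with hlt | hlt
  · obtain ⟨p, hp1, hp2⟩ := exists_hasDerivAt_eq_slope _ _ hlt
      (fun z _ => (hf z).continuousAt.continuousWithinAt) (fun z _ => hf z)
    obtain ⟨q, hq1, hq2⟩ := exists_hasDerivAt_eq_slope _ _ hp1.1
      (fun z _ => (hf' z).continuousAt.continuousWithinAt) (fun z _ => hf' z)
    have hqI : q ∈ I := hconn.out hx hy ⟨hq1.1.le, hq1.2.le.trans hp1.2.le⟩
    have h3 := hp q hqI
    rw [hq2, h0, sub_zero] at h3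
    have h4 : 0 < inner ℝ v (g.jet 1 (p : UnitAddCircle)) :=
      (div_pos_iff_of_pos_right (sub_pos.2 hp1.1)).1 h3
    rw [hp2] at h4
    exact (div_pos_iff_of_pos_right (sub_pos.2 hlt)).1 h4
  · obtain ⟨p, hp1, hp2⟩ := exists_hasDerivAt_eq_slope _ _ hlt
      (fun z _ => (hf z).continuousAt.continuousWithinAt) (fun z _ => hf z)
    obtain ⟨q, hq1, hq2⟩ := exists_hasDerivAt_eq_slope _ _ hp1.2
      (fun z _ => (hf' z).continuousAt.continuousWithinAt) (fun z _ => hf' z)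
    have hqI : q ∈ I := hconn.out hy hx ⟨hp1.1.le.trans hq1.1.le, hq1.2.le⟩
    have h3 := hp q hqI
    rw [hq2, h0, zero_sub] at h3
    have h4 : 0 < -inner ℝ v (g.jet 1 (p : UnitAddCircle)) :=
      (div_pos_iff_of_pos_right (sub_pos.2 hp1.2)).1 h3
    rw [hp2, ← neg_div, neg_sub] at h4
    exact (div_pos_iff_of_pos_right (sub_pos.2 hlt)).1 h4

/-- Where the curvature does not vanish, no three points of a loop are collinear locally. -/
theorem SmoothLoop.eventually_not_collinear (g : SmoothLoop) (hinj : Function.Injective g.toFun)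
    {s₀ : UnitAddCircle} (h₀ : g.curv s₀ ≠ 0) :
    ∀ᶠ c : Torus × UnitAddCircle in 𝓝 ((s₀, s₀), s₀), c.1.1 ≠ c.1.2 →
      g.toFun c.2 ∉ openSegment ℝ (g.toFun c.1.1) (g.toFun c.1.2) := by
  obtain ⟨x₀, rfl⟩ := isOpenQuotientMap_coe_circle.surjective s₀
  have hmap := isOpenQuotientMap_coe_torus.prodMap isOpenQuotientMap_coe_circle
    |>.map_nhds_eq ((x₀, x₀), x₀)
  simp only [Prod.map_apply] at hmap
  rw [← hmap, eventually_map]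
  set a := g.jet 1 (x₀ : UnitAddCircle) with ha
  set b := g.jet 2 (x₀ : UnitAddCircle) with hb
  have hcoe := isOpenQuotientMap_coe_circle.continuous
  -- At `(x₀, x₀)` this determinant is the Gram determinant of velocity and acceleration, nonzero
  -- because the curvature is. It stays nonzero when the two derivatives are taken at different
  -- nearby points.
  have hc : Continuous fun q : ℝ × ℝ =>
      inner ℝ a (g.jet 1 (q.1 : UnitAddCircle)) * inner ℝ b (g.jet 2 (q.2 : UnitAddCircle)) -
      inner ℝ b (g.jet 1 (q.1 : UnitAddCircle)) * inner ℝ a (g.jet 2 (q.2 : UnitAddCircle)) := by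
    have h1 : Continuous fun q : ℝ × ℝ => g.jet 1 (q.1 : UnitAddCircle) :=
      (g.continuous_jet 1).comp (hcoe.comp continuous_fst)
    have h2 : Continuous fun q : ℝ × ℝ => g.jet 2 (q.2 : UnitAddCircle) :=
      (g.continuous_jet 2).comp (hcoe.comp continuous_snd)
    fun_prop
  have h1 := (hc.tendsto (x₀, x₀)).eventually_ne (b₂ := 0) (by
    intro h
    apply h₀
    simp only [← ha, ← hb] at h
    rw [← norm_eq_zero, ← sq_eq_zero_iff, ← real_inner_self_eq_norm_sq, curv,
      inner_normalPart_comm, ← ha, ← hb]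
    simp only [normalPart, inner_sub_left, inner_smul_left, inner_sub_right,
      inner_smul_right, real_inner_self_eq_norm_sq, real_inner_comm a b] at h ⊢
    simp
    linear_combination ‖a‖ ^ 2 * h)
  rw [nhds_prod_eq, eventually_prod_self_iff'] at h1
  obtain ⟨V, hV, hdet⟩ := h1
  obtain ⟨I, hI, hconn, hIV⟩ := eventually_nhds_ordConnected (p := (· ∈ V)) hV
  filter_upwards [prod_mem_nhds (prod_mem_nhds hI hI) hI]
  rintro ⟨⟨x, y⟩, z⟩ ⟨⟨hx, hy⟩, hz⟩ hne hmem
  simp only [Prod.map_apply] at hx hy hz hne hmem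
  have hxy : x ≠ y := fun h => hne (by rw [h])
  have hγ : g.toFun x ≠ g.toFun y := fun h => hne (hinj h)
  have hxz : x ≠ z := by
    rintro rfl
    exact hγ ((left_mem_openSegment_iff).1 hmem)
  have hzy : z ≠ y := by
    rintro rfl
    exact hγ ((right_mem_openSegment_iff).1 hmem)
  obtain ⟨r, -, hr⟩ := exists_pos_smul_of_mem_openSegment hmem
  set d := g.toFun (y : UnitAddCircle) - g.toFun (x : UnitAddCircle) with hd
  -- A nontrivial combination of `a` and `b` orthogonal to the chord: its pairing with the loop
  -- agrees at all three collinear points. Rolle then makes `(α, β)` a kernel vector of a matrix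
  -- with nonzero determinant.
  obtain ⟨α, β, hαβ, hw⟩ : ∃ α β : ℝ, (α ≠ 0 ∨ β ≠ 0) ∧ inner ℝ (α • a + β • b) d = 0 := by
    by_cases had : inner ℝ a d = 0
    · exact ⟨1, 0, Or.inl one_ne_zero, by simpa using had⟩
    · refine ⟨inner ℝ b d, -inner ℝ a d, Or.inr (neg_ne_zero.2 had), ?_⟩
      rw [inner_add_left, inner_smul_left, inner_smul_left]
      simp
      ring
  set w := α • a + β • b with hwdef
  have e1 : inner ℝ w (g.jet 0 (x : UnitAddCircle)) = inner ℝ w (g.jet 0 (z : UnitAddCircle)) := by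
    rw [eq_comm, ← sub_eq_zero, ← inner_sub_right, jet_zero, hr, inner_smul_right, hw, mul_zero]
  have e2 : inner ℝ w (g.jet 0 (x : UnitAddCircle)) = inner ℝ w (g.jet 0 (y : UnitAddCircle)) := by
    rw [eq_comm, ← sub_eq_zero, ← inner_sub_right, jet_zero, hw]
  obtain ⟨p, hp, q, hq, hp0, hq0⟩ := exists_deriv_eq_zero_of_ne hconn
    (g.hasDerivAt_inner_jet 0 w) (g.hasDerivAt_inner_jet 1 w) hx hz hy hxz hzy hxy e1
    (e1.symm.trans e2)
  have hD := hdet p (hIV p hp) q (hIV q hq)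
  simp only [zero_add, Nat.reduceAdd, hwdef, inner_add_left, inner_smul_left] at hp0 hq0 hD
  simp only [conj_trivial] at hp0 hq0
  rcases hαβ with h | h
  · refine hD (mul_left_cancel₀ h ?_)
    linear_combination inner ℝ b (g.jet 2 (q : UnitAddCircle)) * hp0 -
      inner ℝ b (g.jet 1 (p : UnitAddCircle)) * hq0
  · refine hD (mul_left_cancel₀ h ?_)
    linear_combination inner ℝ a (g.jet 1 (p : UnitAddCircle)) * hq0 -
      inner ℝ a (g.jet 2 (q : UnitAddCircle)) * hp0

/-- Short chords of an embedded curved loop do not meet the loop in their interior. -/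
theorem SmoothLoop.eventually_short_chord_clear (g : SmoothLoop)
    (hinj : Function.Injective g.toFun) {s₀ : UnitAddCircle} (h₀ : g.curv s₀ ≠ 0) :
    ∀ᶠ c : Torus in 𝓝 (s₀, s₀), ∀ u, c.1 ≠ c.2 →
      g.toFun u ∉ openSegment ℝ (g.toFun c.1) (g.toFun c.2) := by
  have h : ∀ᶠ c : Torus in 𝓝 (s₀, s₀), ∀ u ∈ (univ : Set UnitAddCircle), c.1 ≠ c.2 →
      g.toFun u ∉ openSegment ℝ (g.toFun c.1) (g.toFun c.2) := by
    refine isCompact_univ.eventually_forall_of_forall_eventually fun u _ => ?_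
    by_cases hu : u = s₀
    · subst hu
      exact g.eventually_not_collinear hinj h₀
    have h1 : Continuous fun q : Torus × UnitAddCircle => g.toFun q.1.1 :=
      g.continuous_toFun.comp (by fun_prop)
    have h2 : Continuous fun q : Torus × UnitAddCircle => g.toFun q.1.2 :=
      g.continuous_toFun.comp (by fun_prop)
    have h3 : Continuous fun q : Torus × UnitAddCircle => g.toFun q.2 :=
      g.continuous_toFun.comp (by fun_prop)
    -- The degenerate segment at `s₀` misses the point `u`, and strictness in the triangle
    -- inequality is stable.
    have hne : dist (g.toFun s₀) (g.toFun u) + dist (g.toFun u) (g.toFun s₀) ≠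
        dist (g.toFun s₀) (g.toFun s₀) := by
      have := dist_pos.2 (hinj.ne hu)
      rw [dist_self, dist_comm]
      positivity
    filter_upwards [(isOpen_ne_fun ((h1.dist h3).add (h3.dist h2)) (h1.dist h2)).mem_nhds
      (show ((s₀, s₀), u) ∈ _ from hne)] with q hq _ hmem
    exact hq (dist_add_dist_eq_iff.2
      (mem_segment_iff_wbtw.1 (openSegment_subset_segment _ _ _ hmem)))
  filter_upwards [h] with c hc u
  exact hc u (mem_univ _)

/-! ### Finite-dimensional perturbations and Hausdorff dimension -/

theorem SmoothLoop.ext_toFun {g h : SmoothLoop} (H : ∀ θ, g.toFun θ = h.toFun θ) : g = h := by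
  cases g
  cases h
  congr
  exact funext H

/-- A family of loops is continuous if all its derivatives are jointly continuous. -/
theorem SmoothLoop.continuous_of_jet {X : Type*} [TopologicalSpace X] {F : X → SmoothLoop}
    (h : ∀ n, Continuous fun q : X × UnitAddCircle => (F q.1).jet n q.2) : Continuous F := by
  refine continuous_induced_rng.2 (continuous_pi fun n => continuous_iff_continuousAt.2 fun x => ?_)
  refine UniformFun.tendsto_iff_tendstoUniformly.2 (Metric.tendstoUniformly_iff.2 fun ε hε => ?_)
  have h1 : ∀ᶠ y in 𝓝 x, ∀ θ ∈ (univ : Set UnitAddCircle),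
      dist ((F x).jet n θ) ((F y).jet n θ) < ε := by
    refine isCompact_univ.eventually_forall_of_forall_eventually fun θ _ => ?_
    have hc : Continuous fun q : X × UnitAddCircle => dist ((F x).jet n q.2) ((F q.1).jet n q.2) :=
      (((F x).continuous_jet n).comp continuous_snd).dist (h n)
    exact (isOpen_lt hc continuous_const).mem_nhds (by simpa using hε)
  filter_upwards [h1] with y hy θ
  exact hy θ (mem_univ _)

/-- The loop `g + ∑ ψ i • a i`. -/
def SmoothLoop.perturb (g : SmoothLoop) {n : ℕ} (ψ : Fin n → UnitAddCircle → ℝ)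
    (hψ : ∀ i, ContDiff ℝ ∞ fun x : ℝ => ψ i x) (a : Fin n → E3) : SmoothLoop where
  toFun θ := g.toFun θ + ∑ i, ψ i θ • a i
  smooth := g.smooth.add (ContDiff.sum fun i _ => (hψ i).smul contDiff_const)

namespace SmoothLoop

variable (g : SmoothLoop) {n : ℕ} (ψ : Fin n → UnitAddCircle → ℝ)
  (hψ : ∀ i, ContDiff ℝ ∞ fun x : ℝ => ψ i x)

theorem perturb_jet (k : ℕ) (a : Fin n → E3) (x : ℝ) : (g.perturb ψ hψ a).jet k x =
    g.jet k x + ∑ i, iteratedDeriv k (fun y : ℝ => ψ i y) x • a i := by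
  induction k generalizing x with
  | zero => simp [jet_zero, perturb]
  | succ k ih =>
    have h1 := (g.perturb ψ hψ a).hasDerivAt_jet k x
    rw [funext ih] at h1
    refine h1.unique ((g.hasDerivAt_jet k x).add (HasDerivAt.fun_sum fun i _ => ?_))
    rw [iteratedDeriv_succ]
    exact (((hψ i).differentiable_iteratedDeriv k
      (WithTop.coe_lt_coe.2 (WithTop.coe_lt_top k)) x).hasDerivAt).smul_const (a i)

theorem continuous_perturb : Continuous (g.perturb ψ hψ) := by
  refine continuous_of_jet fun k => ?_
  refine ((IsOpenQuotientMap.id (X := Fin n → E3)).prodMap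
    isOpenQuotientMap_coe_circle).isQuotientMap.continuous_iff.2 ?_
  have h : (fun q : (Fin n → E3) × UnitAddCircle => (g.perturb ψ hψ q.1).jet k q.2) ∘
      Prod.map id ((↑) : ℝ → UnitAddCircle) = fun q =>
        g.jet k q.2 + ∑ i, iteratedDeriv k (fun y : ℝ => ψ i y) q.2 • q.1 i := by
    ext1 q
    exact perturb_jet g ψ hψ k q.1 q.2
  rw [h]
  have h1 := fun i => (hψ i).continuous_iteratedDeriv k (by exact_mod_cast le_top)
  have h2 := (g.contDiff_jet k).continuous
  refine (h2.comp continuous_snd).add (continuous_finsetSum _ fun i _ => ?_)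
  exact ((h1 i).comp continuous_snd).smul ((continuous_apply i).comp continuous_fst)

/-- A set of Hausdorff dimension below that of the coefficient space has dense complement, so
arbitrarily small coefficients avoid it. This takes the place of a transversality theorem. -/
theorem exists_perturb_mem {O : Set SmoothLoop} (hO : IsOpen O) (hg : g ∈ O)
    {B : Set (Fin n → E3)} (hB : dimH B < (n * 3 : ℕ)) :
    ∃ a, a ∉ B ∧ g.perturb ψ hψ a ∈ O := by
  have hd : Dense Bᶜ := dense_compl_of_dimH_lt_finrank (by
    convert hB
    simp [Module.finrank_pi_fintype])
  have h0 : g.perturb ψ hψ 0 = g := ext_toFun fun θ => by simp [perturb]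
  obtain ⟨a, ha, haB⟩ := hd.inter_open_nonempty _ (hO.preimage (continuous_perturb g ψ hψ))
    ⟨0, by rwa [mem_preimage, h0]⟩
  exact ⟨a, haB, ha⟩

end SmoothLoop

theorem contDiff_matrix_det {P : Type*} [NormedAddCommGroup P] [NormedSpace ℝ P] {n : ℕ}
    {M : P → Matrix (Fin n) (Fin n) ℝ} (hM : ∀ i j, ContDiff ℝ 1 fun p => M p i j) :
    ContDiff ℝ 1 fun p => (M p).det := by
  simp only [Matrix.det_apply']
  exact ContDiff.sum fun σ _ => contDiff_const.mul (contDiff_prod fun i _ => hM _ _)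

/-- The solutions `a` of a family of square linear systems with `d` parameters form a set of
dimension at most `d`. -/
theorem dimH_solutions_le {P : Type*} [NormedAddCommGroup P] [NormedSpace ℝ P]
    [FiniteDimensional ℝ P] {n : ℕ} {M : P → Matrix (Fin n) (Fin n) ℝ}
    (hM : ∀ i j, ContDiff ℝ 1 fun p => M p i j) {T : P → Fin n → E3} (hT : ContDiff ℝ 1 T) :
    dimH {a : Fin n → E3 | ∃ p, (M p).det ≠ 0 ∧ ∀ j, ∑ i, M p j i • a i = T p j} ≤
      Module.finrank ℝ P := by
  -- The solution of the system as a function of the parameters. By Cramer's rule it is `C^1`, hence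
  -- locally Lipschitz, where the determinant is nonzero, so it does not raise dimension.
  set Φ : P → Fin n → E3 := fun p i => ∑ j, (M p)⁻¹ i j • T p j with hΦ
  set Ω : Set P := {p | (M p).det ≠ 0} with hΩ
  have hdet := contDiff_matrix_det hM
  have hinv : ∀ p ∈ Ω, ∀ i j, ContDiffAt ℝ 1 (fun p => (M p)⁻¹ i j) p := by
    intro p hp i j
    simp only [Matrix.inv_def, Matrix.smul_apply, Ring.inverse_eq_inv', smul_eq_mul,
      Matrix.adjugate_apply]
    refine (hdet.contDiffAt.inv hp).mul (ContDiff.contDiffAt (contDiff_matrix_det fun k l => ?_))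
    by_cases hk : k = j
    · subst hk
      simpa using contDiff_const
    · simpa [Matrix.updateRow_apply, hk] using hM k l
  have hΦd : ∀ p ∈ Ω, ContDiffAt ℝ 1 Φ p := fun p hp =>
    contDiffAt_pi.2 fun i => ContDiffAt.sum fun j _ =>
      (hinv p hp i j).smul ((contDiff_pi.1 hT j).contDiffAt)
  have hsub : {a : Fin n → E3 | ∃ p, (M p).det ≠ 0 ∧ ∀ j, ∑ i, M p j i • a i = T p j} ⊆
      Φ '' Ω := by
    rintro a ⟨p, hp, ha⟩
    refine ⟨p, hp, funext fun i => ?_⟩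
    have hMM : (M p)⁻¹ * M p = 1 := Matrix.nonsing_inv_mul _ (isUnit_iff_ne_zero.2 hp)
    calc Φ p i = ∑ j, (M p)⁻¹ i j • ∑ k, M p j k • a k := by simp only [hΦ, ha]
      _ = ∑ k, ((M p)⁻¹ * M p) i k • a k := by
        simp only [Finset.smul_sum, smul_smul, Matrix.mul_apply, Finset.sum_smul]
        exact Finset.sum_comm
      _ = a i := by
        rw [hMM]
        simp [Matrix.one_apply]
  calc _ ≤ dimH (Φ '' Ω) := dimH_mono hsub
    _ ≤ dimH Ω := dimH_image_le_of_locally_lipschitzOn fun p hp => by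
      obtain ⟨C, t, ht, hL⟩ := (hΦd p hp).exists_lipschitzOnWith
      exact ⟨C, t, mem_nhdsWithin_of_mem_nhds ht, hL⟩
    _ ≤ dimH (univ : Set P) := dimH_mono (subset_univ _)
    _ = Module.finrank ℝ P := Real.dimH_univ_eq_finrank P

/-! ### Hermite interpolation by trigonometric polynomials -/

/-- A basis of the real trigonometric polynomials of degree at most two. -/
def trig (i : Fin 5) (x : ℝ) : ℝ :=
  ![1, Real.cos (2 * Real.pi * x), Real.sin (2 * Real.pi * x),
    Real.cos (2 * Real.pi * x) ^ 2 - Real.sin (2 * Real.pi * x) ^ 2,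
    2 * Real.sin (2 * Real.pi * x) * Real.cos (2 * Real.pi * x)] i

theorem contDiff_trig (i : Fin 5) {m : WithTop ℕ∞} : ContDiff ℝ m (trig i) := by
  unfold trig
  fin_cases i <;> simp <;> fun_prop

theorem periodic_trig (i : Fin 5) : Function.Periodic (trig i) 1 := by
  intro x
  have h : 2 * Real.pi * (x + 1) = 2 * Real.pi * x + 2 * Real.pi := by ring
  simp only [trig, h, Real.cos_add_two_pi, Real.sin_add_two_pi]

/-- `trig` as a family of functions on the circle. -/
def circleTrig (i : Fin 5) : UnitAddCircle → ℝ := (periodic_trig i).lift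

theorem circleTrig_coe (i : Fin 5) : (fun x : ℝ => circleTrig i x) = trig i := rfl

theorem contDiff_circleTrig (i : Fin 5) : ContDiff ℝ ∞ fun x : ℝ => circleTrig i x := by
  rw [circleTrig_coe]
  exact contDiff_trig i

theorem hasDerivAt_cos_turn (x : ℝ) : HasDerivAt (fun x => Real.cos (2 * Real.pi * x))
    (-(2 * Real.pi) * Real.sin (2 * Real.pi * x)) x := by
  have h := ((hasDerivAt_id' x).const_mul (2 * Real.pi)).cos
  convert h using 1
  ring

theorem hasDerivAt_sin_turn (x : ℝ) : HasDerivAt (fun x => Real.sin (2 * Real.pi * x))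
    (2 * Real.pi * Real.cos (2 * Real.pi * x)) x := by
  have h := ((hasDerivAt_id' x).const_mul (2 * Real.pi)).sin
  convert h using 1
  ring

theorem deriv_trig (i : Fin 5) (x : ℝ) : deriv (trig i) x = 2 * Real.pi *
    ![0, -Real.sin (2 * Real.pi * x), Real.cos (2 * Real.pi * x),
      -4 * Real.sin (2 * Real.pi * x) * Real.cos (2 * Real.pi * x),
      2 * (Real.cos (2 * Real.pi * x) ^ 2 - Real.sin (2 * Real.pi * x) ^ 2)] i := by
  have hc := hasDerivAt_cos_turn x
  have hs := hasDerivAt_sin_turn x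
  unfold trig
  fin_cases i
  · simp
  · simpa using hc.deriv
  · simpa using hs.deriv
  · refine HasDerivAt.deriv (((hc.fun_pow 2).fun_sub (hs.fun_pow 2)).congr_deriv ?_)
    simp
    ring
  · refine HasDerivAt.deriv (((hs.const_mul 2).fun_mul hc).congr_deriv ?_)
    simp
    ring

theorem deriv_deriv_trig_one (x : ℝ) :
    deriv (deriv (trig 1)) x = -(2 * Real.pi) ^ 2 * Real.cos (2 * Real.pi * x) := by
  have h : deriv (trig 1) = fun x => -(2 * Real.pi) * Real.sin (2 * Real.pi * x) := by
    ext1 x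
    simp [deriv_trig]
  rw [h]
  refine HasDerivAt.deriv (((hasDerivAt_sin_turn x).const_mul _).congr_deriv ?_)
  ring

theorem deriv_deriv_trig_two (x : ℝ) :
    deriv (deriv (trig 2)) x = -(2 * Real.pi) ^ 2 * Real.sin (2 * Real.pi * x) := by
  have h : deriv (trig 2) = fun x => 2 * Real.pi * Real.cos (2 * Real.pi * x) := by
    ext1 x
    simp [deriv_trig]
  rw [h]
  refine HasDerivAt.deriv (((hasDerivAt_cos_turn x).const_mul _).congr_deriv ?_)
  ring

/-- The point of the unit circle in `ℂ` with parameter `x`. -/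
def unitPoint (x : ℝ) : ℂ := ⟨Real.cos (2 * Real.pi * x), Real.sin (2 * Real.pi * x)⟩

theorem unitPoint_ne {x y : ℝ} (h : (x : UnitAddCircle) ≠ y) : unitPoint x ≠ unitPoint y := by
  have key : ∀ x : ℝ, (AddCircle.toCircle (x : UnitAddCircle) : ℂ) = unitPoint x := fun x => by
    rw [AddCircle.toCircle_apply_mk, Circle.coe_exp, Complex.exp_mul_I, ← Complex.ofReal_cos,
      ← Complex.ofReal_sin, div_one, unitPoint, Complex.mk_eq_add_mul_I]
  rw [← key, ← key]
  exact fun he => h (AddCircle.injective_toCircle one_ne_zero (Circle.coe_injective he))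

/-- The complex polynomial that corresponds to a real trigonometric polynomial of degree two. -/
def trigPoly (v : Fin 5 → ℝ) : Polynomial ℂ :=
  Polynomial.C ⟨v 3, v 4⟩ + Polynomial.C ⟨v 1, v 2⟩ * Polynomial.X +
    Polynomial.C ⟨2 * v 0, 0⟩ * Polynomial.X ^ 2 + Polynomial.C ⟨v 1, -v 2⟩ * Polynomial.X ^ 3 +
    Polynomial.C ⟨v 3, -v 4⟩ * Polynomial.X ^ 4

theorem natDegree_trigPoly_lt (v : Fin 5 → ℝ) : (trigPoly v).natDegree < 5 := by
  refine Nat.lt_succ_of_le ?_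
  unfold trigPoly
  compute_degree

theorem eq_zero_of_trigPoly_eq_zero {v : Fin 5 → ℝ} (h : trigPoly v = 0) : v = 0 := by
  have h0 := congrArg (Polynomial.coeff · 0) h
  have h1 := congrArg (Polynomial.coeff · 1) h
  have h2 := congrArg (Polynomial.coeff · 2) h
  simp [trigPoly, Polynomial.coeff_X, Polynomial.coeff_C, Polynomial.coeff_X_pow,
    Complex.ext_iff] at h0 h1 h2
  ext i
  fin_cases i <;> simp [h0, h1, h2]

/-- On the unit circle the conjugate of `z` is its inverse, so the polynomial at `z` is `2 * z ^ 2`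
times the trigonometric sum. -/
theorem isRoot_trigPoly {v : Fin 5 → ℝ} {x : ℝ} (h : ∑ i, trig i x * v i = 0) :
    (trigPoly v).IsRoot (unitPoint x) := by
  have hcs := Real.cos_sq_add_sin_sq (2 * Real.pi * x)
  simp only [trig, Fin.sum_univ_five] at h
  simp [-Real.cos_sq_add_sin_sq] at h
  simp only [Polynomial.IsRoot, trigPoly, unitPoint, Polynomial.eval_add, Polynomial.eval_mul,
    Polynomial.eval_C, Polynomial.eval_X, Polynomial.eval_pow]
  generalize Real.cos (2 * Real.pi * x) = c at *
  generalize Real.sin (2 * Real.pi * x) = s at *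
  have hzw : (⟨c, s⟩ : ℂ) * ⟨c, -s⟩ = 1 := by
    apply Complex.ext
    · simp
      linear_combination hcs
    · simp
      ring
  have hf : (⟨2 * v 0, 0⟩ : ℂ) + ⟨v 1, -v 2⟩ * ⟨c, s⟩ + ⟨v 1, v 2⟩ * ⟨c, -s⟩ +
      ⟨v 3, -v 4⟩ * ⟨c, s⟩ ^ 2 + ⟨v 3, v 4⟩ * ⟨c, -s⟩ ^ 2 = 0 := by
    rw [Complex.ext_iff]
    simp [pow_two]
    constructor
    · linear_combination 2 * h
    · ring
  generalize (⟨c, s⟩ : ℂ) = z at *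
  generalize (⟨c, -s⟩ : ℂ) = w at *
  linear_combination z ^ 2 * hf - (⟨v 3, v 4⟩ * (1 + z * w) + ⟨v 1, v 2⟩ * z) * hzw

/-- Differentiating the relation between polynomial and trigonometric sum along the circle turns a
double zero of the sum into a double root. -/
theorem isRoot_derivative_trigPoly {v : Fin 5 → ℝ} {x : ℝ} (h : ∑ i, trig i x * v i = 0)
    (h' : ∑ i, deriv (trig i) x * v i = 0) :
    (Polynomial.derivative (trigPoly v)).IsRoot (unitPoint x) := by
  have hr := isRoot_trigPoly h
  have hcs := Real.cos_sq_add_sin_sq (2 * Real.pi * x)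
  have hpi : (2 * Real.pi) ≠ 0 := by positivity
  have hf' : 2 * Real.pi * (-Real.sin (2 * Real.pi * x) * v 1 + Real.cos (2 * Real.pi * x) * v 2
      - 4 * Real.sin (2 * Real.pi * x) * Real.cos (2 * Real.pi * x) * v 3
      + 2 * (Real.cos (2 * Real.pi * x) ^ 2 - Real.sin (2 * Real.pi * x) ^ 2) * v 4) = 0 := by
    rw [← h']
    simp only [deriv_trig, Fin.sum_univ_five]
    simp [-Real.cos_sq_add_sin_sq]
    ring
  replace hf' := (mul_eq_zero.1 hf').resolve_left hpi
  have hder : ∀ z, Polynomial.eval z (Polynomial.derivative (trigPoly v)) =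
      ⟨v 1, v 2⟩ + 2 * ⟨2 * v 0, 0⟩ * z + 3 * ⟨v 1, -v 2⟩ * z ^ 2 + 4 * ⟨v 3, -v 4⟩ * z ^ 3 := by
    intro z
    simp [trigPoly]
    ring
  rw [Polynomial.IsRoot, hder, unitPoint]
  simp only [Polynomial.IsRoot, trigPoly, unitPoint, Polynomial.eval_add, Polynomial.eval_mul,
    Polynomial.eval_C, Polynomial.eval_X, Polynomial.eval_pow] at hr
  generalize Real.cos (2 * Real.pi * x) = c at *
  generalize Real.sin (2 * Real.pi * x) = s at *
  have hzw : (⟨c, s⟩ : ℂ) * ⟨c, -s⟩ = 1 := by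
    apply Complex.ext
    · simp
      linear_combination hcs
    · simp
      ring
  have hf : (⟨v 1, -v 2⟩ : ℂ) * ⟨c, s⟩ - ⟨v 1, v 2⟩ * ⟨c, -s⟩ +
      2 * ⟨v 3, -v 4⟩ * ⟨c, s⟩ ^ 2 - 2 * ⟨v 3, v 4⟩ * ⟨c, -s⟩ ^ 2 = 0 := by
    rw [Complex.ext_iff]
    simp [pow_two]
    constructor
    · ring
    · linear_combination (-2) * hf'
  generalize (⟨c, s⟩ : ℂ) = z at *
  generalize (⟨c, -s⟩ : ℂ) = w at *
  have hz : z ≠ 0 := left_ne_zero_of_mul_eq_one hzw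
  refine mul_left_cancel₀ hz ?_
  linear_combination 2 * hr + z ^ 2 * hf -
    (-2 * ⟨v 3, v 4⟩ * (1 + z * w) - ⟨v 1, v 2⟩ * z) * hzw

/-- A trigonometric polynomial of degree two with two double zeros and one more zero vanishes. -/
theorem trig_unisolvent {s t u : ℝ} (hst : (s : UnitAddCircle) ≠ t) (hsu : (s : UnitAddCircle) ≠ u)
    (htu : (t : UnitAddCircle) ≠ u) {v : Fin 5 → ℝ} (h1 : ∑ i, trig i s * v i = 0)
    (h2 : ∑ i, deriv (trig i) s * v i = 0) (h3 : ∑ i, trig i t * v i = 0)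
    (h4 : ∑ i, deriv (trig i) t * v i = 0) (h5 : ∑ i, trig i u * v i = 0) : v = 0 := by
  by_contra hv
  have hP : trigPoly v ≠ 0 := fun h => hv (eq_zero_of_trigPoly_eq_zero h)
  have hs := (Polynomial.le_rootMultiplicity_iff hP).1 ((Polynomial.one_lt_rootMultiplicity_iff_isRoot
    hP).2 ⟨isRoot_trigPoly h1, isRoot_derivative_trigPoly h1 h2⟩)
  have ht := (Polynomial.le_rootMultiplicity_iff hP).1 ((Polynomial.one_lt_rootMultiplicity_iff_isRoot
    hP).2 ⟨isRoot_trigPoly h3, isRoot_derivative_trigPoly h3 h4⟩)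
  have hu := Polynomial.dvd_iff_isRoot.2 (isRoot_trigPoly h5)
  have hcop := fun {x y : ℝ} (h : (x : UnitAddCircle) ≠ y) =>
    Polynomial.isCoprime_X_sub_C_of_isUnit_sub (sub_ne_zero.2 (unitPoint_ne h)).isUnit
  -- Two double roots and a simple one give a divisor of degree 5, while the polynomial has degree
  -- at most 4.
  have hdvd := ((hcop hsu).pow_left.mul_left (hcop htu).pow_left).mul_dvd
    ((hcop hst).pow.mul_dvd hs ht) hu
  refine hP (Polynomial.eq_zero_of_dvd_of_natDegree_lt hdvd ?_)
  refine (natDegree_trigPoly_lt v).trans_le ?_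
  rw [Polynomial.natDegree_mul (by simp [Polynomial.X_sub_C_ne_zero])
    (Polynomial.X_sub_C_ne_zero _), Polynomial.natDegree_mul
    (by simp [Polynomial.X_sub_C_ne_zero]) (by simp [Polynomial.X_sub_C_ne_zero])]
  simp

/-! ### Density of the generic conditions -/

theorem eq_smul_of_normalPart_eq_zero {v w : E3} (hv : v ≠ 0) (h : normalPart v w = 0) :
    ∃ r : ℝ, w = r • v := by
  have h2 : ‖v‖ ^ 2 ≠ 0 := by simpa using hv
  refine ⟨(‖v‖ ^ 2)⁻¹ * inner ℝ v w, ?_⟩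
  rw [normalPart, sub_eq_zero] at h
  rw [mul_smul, ← h, inv_smul_smul₀ h2]

/-- Every neighbourhood of an embedded loop contains a loop with nowhere vanishing curvature. -/
theorem exists_curved_mem {O : Set SmoothLoop} (hO : IsOpen O) {g : SmoothLoop} (hg : g ∈ O)
    (hemb : g ∈ embeddedLoops) : ∃ h ∈ O, h ∈ embeddedLoops ∧ h ∈ curvedLoops := by
  set φ : Fin 2 → Fin 5 := ![1, 2] with hφ
  -- Zero curvature at `x` means velocity `v` and acceleration `r • v`. The data `(x, v, r)` have
  -- dimension 5 and determine the two coefficient vectors, which range over a space of dimension 6.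
  set M : ℝ × E3 × ℝ → Matrix (Fin 2) (Fin 2) ℝ := fun p =>
    ![fun i => deriv (trig (φ i)) p.1, fun i => deriv (deriv (trig (φ i))) p.1] with hM
  set T : ℝ × E3 × ℝ → Fin 2 → E3 := fun p =>
    ![p.2.1 - g.jet 1 p.1, p.2.2 • p.2.1 - g.jet 2 p.1] with hT
  have hder : ∀ i, ContDiff ℝ ∞ (deriv (trig i)) := fun i =>
    (contDiff_infty_iff_deriv.1 (contDiff_trig i)).2
  have hder2 : ∀ i, ContDiff ℝ ∞ (deriv (deriv (trig i))) := fun i =>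
    (contDiff_infty_iff_deriv.1 (hder i)).2
  have hMc : ∀ i j, ContDiff ℝ 1 fun p => M p i j := by
    intro i j
    fin_cases i
    · exact ((hder (φ j)).of_le (by exact_mod_cast le_top)).comp contDiff_fst
    · exact ((hder2 (φ j)).of_le (by exact_mod_cast le_top)).comp contDiff_fst
  have hjet : ∀ k, ContDiff ℝ 1 fun p : ℝ × E3 × ℝ => g.jet k p.1 := fun k =>
    ((g.contDiff_jet k).of_le (by exact_mod_cast le_top)).comp contDiff_fst
  have hTc : ContDiff ℝ 1 T := by
    refine contDiff_pi.2 fun j => ?_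
    fin_cases j
    · exact contDiff_snd.fst.sub (hjet 1)
    · exact (contDiff_snd.snd.smul contDiff_snd.fst).sub (hjet 2)
  obtain ⟨a, haB, haO⟩ := g.exists_perturb_mem (fun i => circleTrig (φ i))
    (fun i => contDiff_circleTrig (φ i)) (hO.inter isOpen_embeddedLoops) ⟨hg, hemb⟩
    (lt_of_le_of_lt (dimH_solutions_le hMc hTc) (by
      simp only [Module.finrank_prod, finrank_euclideanSpace_fin, Module.finrank_self]
      norm_num))
  refine ⟨_, haO.1, haO.2, fun θ hθ => haB ?_⟩
  obtain ⟨x, rfl⟩ := isOpenQuotientMap_coe_circle.surjective θ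
  obtain ⟨r, hr⟩ := eq_smul_of_normalPart_eq_zero (haO.2.2 _) hθ
  rw [SmoothLoop.perturb_jet, SmoothLoop.perturb_jet] at hr
  refine ⟨(x, g.jet 1 x + ∑ i, deriv (trig (φ i)) x • a i, r), ?_, fun j => ?_⟩
  -- The determinant is the constant `(2 * π) ^ 3`.
  · rw [Matrix.det_fin_two]
    have hd1 : deriv (trig 1) x = -(2 * Real.pi) * Real.sin (2 * Real.pi * x) := by
      simp [deriv_trig]
    have hd2 : deriv (trig 2) x = 2 * Real.pi * Real.cos (2 * Real.pi * x) := by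
      simp [deriv_trig]
    simp only [hM, hφ, Matrix.cons_val_zero, Matrix.cons_val_one, hd1, hd2, deriv_deriv_trig_one,
      deriv_deriv_trig_two]
    have hcs := Real.cos_sq_add_sin_sq (2 * Real.pi * x)
    have h3 : (2 * Real.pi) ^ 3 ≠ 0 := by positivity
    intro h
    apply h3
    linear_combination h - (2 * Real.pi) ^ 3 * hcs
  · fin_cases j
    · simp [hM, hT]
    · simp only [iteratedDeriv_succ, iteratedDeriv_zero, circleTrig_coe] at hr
      exact eq_sub_of_add_eq' hr

/-- The direction with coordinates `d * (1, y, z)`, where the first coordinate is the `k`-th. -/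
def chartDir (k : Fin 3) (d y z : ℝ) : E3 :=
  d • (EuclideanSpace.single k (1 : ℝ) + y • EuclideanSpace.single (k + 1) (1 : ℝ) +
    z • EuclideanSpace.single (k + 2) (1 : ℝ))

/-- The vectors orthogonal to `chartDir k d y z`. -/
def chartNormal (k : Fin 3) (y z p q : ℝ) : E3 :=
  (-(y * p + z * q)) • EuclideanSpace.single k (1 : ℝ) + p • EuclideanSpace.single (k + 1) (1 : ℝ) +
    q • EuclideanSpace.single (k + 2) (1 : ℝ)

/-- Dividing by a nonzero coordinate `k` of `D`, orthogonality to `D` can be solved for that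
coordinate, so an orthogonal velocity costs only two parameters. The indices `k + 1` and `k + 2` are
modulo 3. -/
theorem exists_chart {D : E3} (hD : D ≠ 0) : ∃ k d y z, D = chartDir k d y z ∧
    ∀ v : E3, inner ℝ v D = 0 → ∃ p q, v = chartNormal k y z p q := by
  obtain ⟨k, hk⟩ : ∃ k, D k ≠ 0 := by
    by_contra! h
    exact hD (by ext i; simpa using h i)
  refine ⟨k, D k, D (k + 1) / D k, D (k + 2) / D k, ?_, fun v hv => ⟨v (k + 1), v (k + 2), ?_⟩⟩
  · ext i
    fin_cases k <;> fin_cases i <;> simp [chartDir] at hk ⊢ <;> field_simp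
  · simp only [PiLp.inner_apply, Fin.sum_univ_three, RCLike.inner_apply, conj_trivial] at hv
    ext i
    fin_cases k <;> fin_cases i <;> simp [chartNormal] at hk hv ⊢ <;> field_simp <;>
      linear_combination hv

/-- The parameters of a configuration of a binormal chord and an interior point on it: the three
parameters on the circle, the startpoint of the chord, its direction in a chart, the velocities at
its endpoints and the ratio in which the interior point divides it. -/
abbrev ChordParam : Type := (ℝ × ℝ × ℝ) × E3 × (Fin 8 → ℝ)

/-- The Hermite interpolation matrix of `trig` for values and derivatives at the endpoints and
values at the interior point. -/
def hermiteMatrix (c : ChordParam) : Matrix (Fin 5) (Fin 5) ℝ :=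
  ![fun i => trig i c.1.1, fun i => deriv (trig i) c.1.1, fun i => trig i c.1.2.1,
    fun i => deriv (trig i) c.1.2.1, fun i => trig i c.1.2.2]

/-- The interpolation data that change `g` to a loop with the given configuration. -/
def chordTarget (g : SmoothLoop) (k : Fin 3) (c : ChordParam) : Fin 5 → E3 :=
  ![c.2.1 - g.jet 0 c.1.1,
    chartNormal k (c.2.2 1) (c.2.2 2) (c.2.2 3) (c.2.2 4) - g.jet 1 c.1.1,
    c.2.1 + chartDir k (c.2.2 0) (c.2.2 1) (c.2.2 2) - g.jet 0 c.1.2.1,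
    chartNormal k (c.2.2 1) (c.2.2 2) (c.2.2 5) (c.2.2 6) - g.jet 1 c.1.2.1,
    c.2.1 + c.2.2 7 • chartDir k (c.2.2 0) (c.2.2 1) (c.2.2 2) - g.jet 0 c.1.2.2]

theorem contDiff_deriv_trig (i : Fin 5) : ContDiff ℝ 1 (deriv (trig i)) :=
  ((contDiff_infty_iff_deriv.1 (contDiff_trig i)).2).of_le (by exact_mod_cast le_top)

theorem contDiff_hermiteMatrix (i j : Fin 5) : ContDiff ℝ 1 fun c => hermiteMatrix c i j := by
  fin_cases i
  · exact (contDiff_trig j).comp contDiff_fst.fst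
  · exact (contDiff_deriv_trig j).comp contDiff_fst.fst
  · exact (contDiff_trig j).comp contDiff_fst.snd.fst
  · exact (contDiff_deriv_trig j).comp contDiff_fst.snd.fst
  · exact (contDiff_trig j).comp contDiff_fst.snd.snd

theorem contDiff_chordTarget (g : SmoothLoop) (k : Fin 3) : ContDiff ℝ 1 (chordTarget g k) := by
  have hjet : ∀ n, ContDiff ℝ 1 fun x : ℝ => g.jet n x := fun n =>
    (g.contDiff_jet n).of_le (by exact_mod_cast le_top)
  refine contDiff_pi.2 fun j => ?_
  fin_cases j
  · exact contDiff_snd.fst.sub ((hjet 0).comp contDiff_fst.fst)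
  · refine ContDiff.sub ?_ ((hjet 1).comp contDiff_fst.fst)
    unfold chartNormal
    fun_prop
  · refine ContDiff.sub ?_ ((hjet 0).comp contDiff_fst.snd.fst)
    unfold chartDir
    fun_prop
  · refine ContDiff.sub ?_ ((hjet 1).comp contDiff_fst.snd.fst)
    unfold chartNormal
    fun_prop
  · refine ContDiff.sub ?_ ((hjet 0).comp contDiff_fst.snd.snd)
    unfold chartDir
    fun_prop

theorem det_hermiteMatrix_ne_zero {c : ChordParam} (hst : (c.1.1 : UnitAddCircle) ≠ c.1.2.1)
    (hsu : (c.1.1 : UnitAddCircle) ≠ c.1.2.2) (htu : (c.1.2.1 : UnitAddCircle) ≠ c.1.2.2) :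
    (hermiteMatrix c).det ≠ 0 := by
  intro h
  obtain ⟨v, hv, hMv⟩ := Matrix.exists_mulVec_eq_zero_iff.2 h
  exact hv (trig_unisolvent hst hsu htu (congrFun hMv 0) (congrFun hMv 1) (congrFun hMv 2)
    (congrFun hMv 3) (congrFun hMv 4))

/-- Every neighbourhood of an embedded loop contains a loop without binormal chords that meet the
loop in their interior. -/
theorem exists_clear_mem {O : Set SmoothLoop} (hO : IsOpen O) {g : SmoothLoop} (hg : g ∈ O)
    (hemb : g ∈ embeddedLoops) : ∃ h ∈ O, h ∈ embeddedLoops ∧ h ∈ clearLoops := by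
  obtain ⟨a, haB, haO⟩ := g.exists_perturb_mem circleTrig contDiff_circleTrig
    (hO.inter isOpen_embeddedLoops) ⟨hg, hemb⟩ (B := ⋃ k, {a : Fin 5 → E3 | ∃ c,
      (hermiteMatrix c).det ≠ 0 ∧ ∀ j, ∑ i, hermiteMatrix c j i • a i = chordTarget g k c j})
    -- The configurations have `3 + 3 + 8 = 14` parameters in each of the three charts, against `5 *
    -- 3 = 15` coefficients.
    (by
      rw [dimH_iUnion]
      refine lt_of_le_of_lt (iSup_le fun k =>
        dimH_solutions_le contDiff_hermiteMatrix (contDiff_chordTarget g k)) ?_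
      simp only [Module.finrank_prod, finrank_euclideanSpace_fin, Module.finrank_self,
        Module.finrank_fin_fun]
      norm_num)
  refine ⟨_, haO.1, haO.2, fun s t u hst hs ht hu => haB ?_⟩
  obtain ⟨x, rfl⟩ := isOpenQuotientMap_coe_circle.surjective s
  obtain ⟨y, rfl⟩ := isOpenQuotientMap_coe_circle.surjective t
  obtain ⟨z, rfl⟩ := isOpenQuotientMap_coe_circle.surjective u
  have hj0 := fun x => SmoothLoop.perturb_jet g circleTrig contDiff_circleTrig 0 a x
  have hj1 := fun x => SmoothLoop.perturb_jet g circleTrig contDiff_circleTrig 1 a x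
  simp only [iteratedDeriv_one, iteratedDeriv_zero, circleTrig_coe] at hj0 hj1
  generalize g.perturb circleTrig contDiff_circleTrig a = h at *
  have hne : h.toFun x ≠ h.toFun y := fun h' => hst (haO.2.1 h')
  -- The Hermite determinant is nonzero only for distinct nodes; an open segment between distinct
  -- points omits its endpoints.
  have hxz : (x : UnitAddCircle) ≠ z := by
    intro he
    rw [← he] at hu
    exact hne (left_mem_openSegment_iff.1 hu)
  have hyz : (y : UnitAddCircle) ≠ z := by
    intro he
    rw [← he] at hu
    exact hne (right_mem_openSegment_iff.1 hu)
  obtain ⟨r, -, hr⟩ := exists_pos_smul_of_mem_openSegment hu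
  obtain ⟨k, d, b, c, hD, hv⟩ := exists_chart (sub_ne_zero.2 hne.symm)
  obtain ⟨p, q, hpq⟩ := hv _ hs
  obtain ⟨p', q', hpq'⟩ := hv (h.jet 1 y) (by rw [← neg_sub, inner_neg_right, ht, neg_zero])
  refine mem_iUnion.2 ⟨k, ((x, y, z), h.toFun x, ![d, b, c, p, q, p', q', r]),
    det_hermiteMatrix_ne_zero hst hxz hyz, fun j => ?_⟩
  fin_cases j
  · exact eq_sub_of_add_eq' (hj0 x).symm
  · exact eq_sub_of_add_eq' ((hj1 x).symm.trans hpq)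
  · refine eq_sub_of_add_eq' ((hj0 y).symm.trans ?_)
    change h.toFun y = h.toFun x + chartDir k d b c
    rw [← hD, add_sub_cancel]
  · exact eq_sub_of_add_eq' ((hj1 y).symm.trans hpq')
  · refine eq_sub_of_add_eq' ((hj0 z).symm.trans ?_)
    change h.toFun z = h.toFun x + r • chartDir k d b c
    rw [← hD, ← hr, add_sub_cancel]

namespace Knot

theorem mem_embeddedLoops (K : Knot) : K.toSmoothLoop ∈ embeddedLoops :=
  ⟨K.injective, K.immersion⟩

/-- Knots with nowhere vanishing curvature that do not meet the interior of their binormal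
chords. -/
def generic : Set Knot :=
  Knot.toSmoothLoop ⁻¹' (curvedLoops ∩ (embeddedLoops ∩ clearLoops))

theorem isOpen_generic : IsOpen generic :=
  (isOpen_curvedLoops.inter isOpen_embeddedLoops_inter_clearLoops).preimage continuous_induced_dom

/-- The curvature is made nonzero first; being open, this survives the second perturbation, which
clears the binormal chords. -/
theorem dense_generic : Dense generic := by
  intro K
  rw [mem_closure_iff]
  intro O hO hK
  obtain ⟨O', hO', rfl⟩ := isOpen_induced_iff.1 hO
  obtain ⟨g₁, h₁, hemb₁, hcurv₁⟩ := exists_curved_mem hO' hK K.mem_embeddedLoops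
  obtain ⟨g₂, h₂, hemb₂, hclear⟩ := exists_clear_mem (hO'.inter isOpen_curvedLoops)
    ⟨h₁, hcurv₁⟩ hemb₁
  exact ⟨⟨g₂, hemb₂.1, hemb₂.2⟩, h₂.1, h₂.2, hemb₂, hclear⟩

end Knot

/-! ### Rotating a framing -/

/-- The cross product of `ℝ³`. -/
def cross (v w : E3) : E3 :=
  !₂[v 1 * w 2 - v 2 * w 1, v 2 * w 0 - v 0 * w 2, v 0 * w 1 - v 1 * w 0]

theorem inner_cross_left (v w : E3) : inner ℝ v (cross v w) = 0 := by
  simp [cross, PiLp.inner_apply, Fin.sum_univ_three]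
  ring

theorem inner_cross_right (v w : E3) : inner ℝ w (cross v w) = 0 := by
  simp [cross, PiLp.inner_apply, Fin.sum_univ_three]
  ring

theorem norm_cross_sq (v w : E3) :
    ‖cross v w‖ ^ 2 = ‖v‖ ^ 2 * ‖w‖ ^ 2 - inner ℝ v w ^ 2 := by
  simp only [EuclideanSpace.real_norm_sq_eq, PiLp.inner_apply, Fin.sum_univ_three]
  simp [cross]
  ring

namespace SmoothLoop

/-- The linear combination `a • g + b • h` of two loops. -/
def comb (g h : SmoothLoop) (a b : ℝ) : SmoothLoop where
  toFun θ := a • g.toFun θ + b • h.toFun θ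
  smooth := (g.smooth.const_smul a).add (h.smooth.const_smul b)

theorem comb_jet (g h : SmoothLoop) (a b : ℝ) (k : ℕ) (x : ℝ) :
    (g.comb h a b).jet k x = a • g.jet k x + b • h.jet k x := by
  induction k generalizing x with
  | zero => rfl
  | succ k ih =>
    have h1 := (g.comb h a b).hasDerivAt_jet k x
    rw [funext ih] at h1
    exact h1.unique (((g.hasDerivAt_jet k x).const_smul a).fun_add
      ((h.hasDerivAt_jet k x).const_smul b))

theorem continuous_comb (g h : SmoothLoop) : Continuous fun q : ℝ × ℝ => g.comb h q.1 q.2 := by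
  refine continuous_of_jet fun k => ?_
  have h1 : (fun q : (ℝ × ℝ) × UnitAddCircle => (g.comb h q.1.1 q.1.2).jet k q.2) =
      fun q => q.1.1 • g.jet k q.2 + q.1.2 • h.jet k q.2 := by
    ext1 ⟨q, θ⟩
    obtain ⟨x, rfl⟩ := isOpenQuotientMap_coe_circle.surjective θ
    exact comb_jet g h q.1 q.2 k x
  rw [h1]
  exact (continuous_fst.fst.smul ((g.continuous_jet k).comp continuous_snd)).add
    (continuous_fst.snd.smul ((h.continuous_jet k).comp continuous_snd))

end SmoothLoop

namespace Knot

theorem mem_normalPlane {K : Knot} {θ : UnitAddCircle} {v : E3} :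
    v ∈ K.normalPlane θ ↔ inner ℝ (K.jet 1 θ) v = 0 :=
  Submodule.mem_orthogonal_singleton_iff_inner_right

namespace Framing

variable {K : Knot} (ν : K.Framing)

theorem inner_jet_eq_zero (θ : UnitAddCircle) : inner ℝ (K.jet 1 θ) (ν.toFun θ) = 0 :=
  mem_normalPlane.1 (ν.normal θ)

/-- The framing rotated by a quarter turn, as a loop. -/
def quarterLoop : SmoothLoop where
  toFun θ := ‖K.jet 1 θ‖⁻¹ • cross (K.jet 1 θ) (ν.toFun θ)
  smooth := by
    have h1 := K.contDiff_jet 1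
    have h2 := ν.smooth
    have h3 := fun i => contDiff_piLp_apply (p := 2) (i := i) |>.comp h1
    have h4 := fun i => contDiff_piLp_apply (p := 2) (i := i) |>.comp h2
    refine ((h1.norm ℝ fun x => K.immersion x).inv fun x => norm_ne_zero_iff.2
      (K.immersion x)).smul ((contDiff_piLp (p := 2)).2 fun i => ?_)
    fin_cases i
    · exact ((h3 1).mul (h4 2)).sub ((h3 2).mul (h4 1))
    · exact ((h3 2).mul (h4 0)).sub ((h3 0).mul (h4 2))
    · exact ((h3 0).mul (h4 1)).sub ((h3 1).mul (h4 0))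

theorem inner_jet_quarterLoop (θ : UnitAddCircle) :
    inner ℝ (K.jet 1 θ) (ν.quarterLoop.toFun θ) = 0 := by
  simp only [quarterLoop, inner_smul_right, inner_cross_left, mul_zero]

theorem inner_quarterLoop (θ : UnitAddCircle) :
    inner ℝ (ν.toFun θ) (ν.quarterLoop.toFun θ) = 0 := by
  simp only [quarterLoop, inner_smul_right, inner_cross_right, mul_zero]

theorem norm_quarterLoop (θ : UnitAddCircle) : ‖ν.quarterLoop.toFun θ‖ = 1 := by
  have h : ‖K.jet 1 θ‖ ≠ 0 := norm_ne_zero_iff.2 (K.immersion θ)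
  rw [← sq_eq_sq₀ (norm_nonneg _) zero_le_one, quarterLoop, norm_smul, mul_pow, norm_cross_sq,
    ν.inner_jet_eq_zero, ν.norm_eq_one, norm_inv, norm_norm]
  field_simp
  ring

/-- The framing rotated by the constant angle `φ`. -/
def rotate (φ : ℝ) : K.Framing where
  toSmoothLoop := ν.toSmoothLoop.comb ν.quarterLoop (Real.cos φ) (Real.sin φ)
  norm_eq_one θ := by
    rw [← sq_eq_sq₀ (norm_nonneg _) zero_le_one]
    simp only [SmoothLoop.comb]
    rw [norm_add_sq_real, norm_smul, norm_smul, inner_smul_left, inner_smul_right,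
      ν.inner_quarterLoop, ν.norm_quarterLoop, ν.norm_eq_one]
    simp
  normal θ := by
    rw [mem_normalPlane]
    simp only [SmoothLoop.comb]
    rw [inner_add_right, inner_smul_right, inner_smul_right, ν.inner_jet_quarterLoop,
      ν.inner_jet_eq_zero]
    simp

theorem continuous_rotate : Continuous ν.rotate :=
  continuous_induced_rng.2 ((SmoothLoop.continuous_comb _ _).comp
    (Real.continuous_cos.prodMk Real.continuous_sin))

theorem ext_toSmoothLoop {ν μ : K.Framing} (h : ν.toSmoothLoop = μ.toSmoothLoop) : ν = μ := by
  cases ν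
  cases μ
  congr

theorem rotate_zero : ν.rotate 0 = ν :=
  ext_toSmoothLoop (SmoothLoop.ext_toFun fun θ => by simp [rotate, SmoothLoop.comb])

theorem isOpen_setOf_ne (s : UnitAddCircle) (e : E3) : IsOpen {ν : K.Framing | ν.toFun s ≠ e} :=
  isOpen_ne_fun (SmoothLoop.continuous_toFun_comp
    (g := fun ν : K.Framing => ν.toSmoothLoop) continuous_induced_dom continuous_const)
    continuous_const

/-- If the framing takes the forbidden value, a rotation by a small angle `φ > 0` leaves it: the
component along the quarter turn changes from 0 to `sin φ`. -/
theorem dense_setOf_ne (s : UnitAddCircle) (e : E3) : Dense {ν : K.Framing | ν.toFun s ≠ e} := by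
  intro ν
  by_cases h : ν.toFun s = e
  · have ht : Tendsto ν.rotate (𝓝[>] 0) (𝓝 ν) := by
      have := ν.continuous_rotate.tendsto 0
      rw [rotate_zero] at this
      exact this.mono_left nhdsWithin_le_nhds
    refine mem_closure_of_tendsto ht ?_
    filter_upwards [Ioo_mem_nhdsGT Real.pi_pos] with φ hφ he
    have hsin := Real.sin_pos_of_pos_of_lt_pi hφ.1 hφ.2
    have h1 : inner ℝ ((ν.rotate φ).toFun s) (ν.quarterLoop.toFun s) = Real.sin φ := by
      simp only [rotate, SmoothLoop.comb]
      rw [inner_add_left, inner_smul_left, inner_smul_left, ν.inner_quarterLoop,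
        real_inner_self_eq_norm_sq, ν.norm_quarterLoop]
      simp
    rw [he, ← h, ν.inner_quarterLoop] at h1
    exact hsin.ne h1
  · exact subset_closure h

theorem isOpen_and_dense_of_finite {C : Set (UnitAddCircle × E3)} (hC : C.Finite) :
    IsOpen {ν : K.Framing | ∀ x ∈ C, ν.toFun x.1 ≠ x.2} ∧
      Dense {ν : K.Framing | ∀ x ∈ C, ν.toFun x.1 ≠ x.2} := by
  induction C, hC using Set.Finite.induction_on with
  | empty => simp
  | @insert x C _ _ ih =>
    have h : {ν : K.Framing | ∀ y ∈ insert x C, ν.toFun y.1 ≠ y.2} =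
        {ν | ν.toFun x.1 ≠ x.2} ∩ {ν : K.Framing | ∀ y ∈ C, ν.toFun y.1 ≠ y.2} := by
      ext ν
      simp
    rw [h]
    exact ⟨(isOpen_setOf_ne x.1 x.2).inter ih.1,
      (dense_setOf_ne x.1 x.2).inter_of_isOpen_left ih.2 (isOpen_setOf_ne x.1 x.2)⟩

end Framing

/-! ### Limits of cords that meet the framing -/

/-- The limit direction, in the normal plane at the startpoint, of the cords near `c`. -/
def startDir (K : Knot) (c : Torus) : E3 :=
  open scoped Classical in
  if c.1 = c.2 then K.curv c.1 else normalPart (K.jet 1 c.1) (K.toFun c.2 - K.toFun c.1)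

theorem exists_of_mem_Fs {K : Knot} {ν : K.Framing} {c : Torus} (hc : c ∈ K.Fs ν) :
    ∃ β : ℝ, 0 < β ∧
      normalPart (K.jet 1 c.1) (K.toFun c.2 - K.toFun c.1) = β • ν.toFun c.1 := by
  obtain ⟨α, hα, h⟩ := hc
  have himm : K.jet 1 c.1 ≠ 0 := K.immersion c.1
  refine ⟨‖K.jet 1 c.1‖ ^ 2 * α, by positivity, ?_⟩
  rw [← smul_starProjection_orthogonal himm, mul_smul, ← h]
  rfl

/-- Off the diagonal the normal part of the cord varies continuously, and being a nonnegative
multiple of the framing is a closed condition. On the diagonal that condition degenerates to `0 =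
0`, and a linear functional separates short chords from the framing instead. -/
theorem notMem_closure_Fs {K : Knot} {ν : K.Framing} {c : Torus} (h₀ : K.startDir c ≠ 0)
    (hν : ν.toFun c.1 ≠ ‖K.startDir c‖⁻¹ • K.startDir c) : c ∉ closure (K.Fs ν) := by
  have hn0 : ‖K.startDir c‖ ≠ 0 := norm_ne_zero_iff.2 h₀
  by_cases hc : c.1 = c.2
  · obtain ⟨s, t⟩ := c
    obtain rfl : s = t := hc
    set v := K.startDir (s, s) with hv
    have hvc : v = K.curv s := by simp [hv, startDir]
    set e := ‖v‖⁻¹ • v with he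
    have hve : v = ‖v‖ • e := by rw [he, smul_inv_smul₀ hn0]
    have he1 : ‖e‖ = 1 := by rw [he, norm_smul, norm_inv, norm_norm, inv_mul_cancel₀ hn0]
    have hlt : inner ℝ (ν.toFun s) e < 1 :=
      (inner_lt_one_iff_real_of_norm_eq_one (ν.norm_eq_one s) he1).2 hν
    -- For distinct unit vectors, pairing with `e - ν.toFun s` is positive on the first and negative
    -- on the second; both signs persist for nearby cords.
    have hw : 0 < inner ℝ (e - ν.toFun s) (K.curv s) := by
      rw [← hvc, hve, inner_smul_right, inner_sub_left, real_inner_self_eq_norm_sq, he1]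
      have : 0 < ‖v‖ := norm_pos_iff.2 h₀
      nlinarith
    have hwν : ∀ᶠ c : Torus in 𝓝 (s, s), inner ℝ (e - ν.toFun s) (ν.toFun c.1) < 0 := by
      refine (isOpen_lt (continuous_const.inner (ν.continuous_toFun.comp continuous_fst))
        continuous_const).mem_nhds ?_
      change inner ℝ (e - ν.toFun s) (ν.toFun s) < 0
      rw [inner_sub_left, real_inner_self_eq_norm_sq, ν.norm_eq_one, real_inner_comm]
      linarith
    rw [mem_closure_iff_frequently]
    intro hf
    refine hf ?_
    filter_upwards [K.eventually_inner_normalPart_pos hw, hwν] with c hc1 hc2 hmem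
    obtain ⟨β, hβ, h⟩ := exists_of_mem_Fs hmem
    have hne : c.1 ≠ c.2 := by
      intro heq
      rw [← heq, sub_self, normalPart_zero_right] at h
      have h3 := congrArg norm h
      rw [norm_zero, norm_smul, ν.norm_eq_one, mul_one, eq_comm, norm_eq_zero] at h3
      exact hβ.ne' h3
    have h4 := hc1 hne
    rw [h, inner_smul_right] at h4
    nlinarith
  · intro hmem
    have hcl : IsClosed {c : Torus | normalPart (K.jet 1 c.1) (K.toFun c.2 - K.toFun c.1) =
        ‖normalPart (K.jet 1 c.1) (K.toFun c.2 - K.toFun c.1)‖ • ν.toFun c.1} := by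
      have h1 : Continuous fun c : Torus =>
          normalPart (K.jet 1 c.1) (K.toFun c.2 - K.toFun c.1) :=
        continuous_normalPart ((K.continuous_jet 1).comp continuous_fst)
          ((K.continuous_toFun.comp continuous_snd).sub (K.continuous_toFun.comp continuous_fst))
      exact isClosed_eq h1 (h1.norm.smul (ν.continuous_toFun.comp continuous_fst))
    have hsub : K.Fs ν ⊆ {c : Torus | normalPart (K.jet 1 c.1) (K.toFun c.2 - K.toFun c.1) =
        ‖normalPart (K.jet 1 c.1) (K.toFun c.2 - K.toFun c.1)‖ • ν.toFun c.1} := by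
      intro c' hc'
      obtain ⟨β, hβ, h⟩ := exists_of_mem_Fs hc'
      change normalPart _ _ = _
      rw [h, norm_smul, ν.norm_eq_one, mul_one, Real.norm_eq_abs, abs_of_pos hβ]
    have h := closure_minimal hsub hcl hmem
    have hd : K.startDir c = normalPart (K.jet 1 c.1) (K.toFun c.2 - K.toFun c.1) := by
      simp [startDir, hc]
    change normalPart _ _ = _ at h
    rw [← hd] at h
    apply hν
    nth_rewrite 2 [h]
    rw [inv_smul_smul₀ hn0]

theorem mem_closure_Fe {K : Knot} {ν : K.Framing} {c : Torus} (hc : c ∈ closure (K.Fe ν)) :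
    c.swap ∈ closure (K.Fs ν) :=
  map_mem_closure continuous_swap hc fun _ h => h

end Knot

/-! ### Critical points of Morse functions and of the energy -/

namespace Torus

/-- The lift of a function on the torus to the plane. -/
def lift (h : Torus → ℝ) (x : ℝ × ℝ) : ℝ := h (x.1, x.2)

theorem inCoords_coe (h : Torus → ℝ) (x : ℝ × ℝ) :
    inCoords h (x.1, x.2) = fun q => lift h (x + q) := rfl

theorem fderiv_inCoords_coe (h : Torus → ℝ) (x : ℝ × ℝ) :
    fderiv ℝ (inCoords h (x.1, x.2)) = fun q => fderiv ℝ (lift h) (x + q) := by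
  ext1 q
  rw [inCoords_coe, fderiv_comp_add_left]

theorem isCritical_coe {h : Torus → ℝ} {x : ℝ × ℝ} :
    IsCritical h (x.1, x.2) ↔ fderiv ℝ (lift h) x = 0 := by
  simp only [IsCritical, fderiv_inCoords_coe, add_zero]

theorem hessian_coe (h : Torus → ℝ) (x : ℝ × ℝ) :
    hessian h (x.1, x.2) = fderiv ℝ (fderiv ℝ (lift h)) x := by
  rw [hessian, fderiv_inCoords_coe, fderiv_comp_add_left, add_zero]

/-- At a critical point the nondegenerate Hessian is an injective derivative of the differential, so
the differential has an isolated zero there. -/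
theorem IsMorse.eventually_not_critical {h : Torus → ℝ} (hh : IsMorse h) (c : Torus) :
    ∀ᶠ c' in 𝓝 c, IsCritical h c' → c' = c := by
  obtain ⟨x, rfl⟩ := isOpenQuotientMap_coe_torus.surjective c
  rw [← isOpenQuotientMap_coe_torus.map_nhds_eq x, eventually_map]
  have hs : ContDiff ℝ ∞ (lift h) := hh.1
  have hd : ContDiff ℝ 1 (fderiv ℝ (lift h)) := hs.fderiv_right (by norm_cast)
  by_cases hx : fderiv ℝ (lift h) x = 0
  · have hinj : LinearMap.ker (fderiv ℝ (fderiv ℝ (lift h)) x : ℝ × ℝ →ₗ[ℝ] (ℝ × ℝ →L[ℝ] ℝ)) = ⊥ := by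
      refine LinearMap.ker_eq_bot'.2 fun v hv => hh.2 (x.1, x.2) (isCritical_coe.2 hx) v fun w => ?_
      rw [hessian_coe]
      exact congrArg (fun A : ℝ × ℝ →L[ℝ] ℝ => A w) hv
    obtain ⟨C, -, hC⟩ := LinearMap.exists_antilipschitzWith _ hinj
    have h1 := ((hd.differentiable one_ne_zero x).hasFDerivAt).eventually_ne ⟨C, hC⟩ (c := 0)
    rw [eventually_nhdsWithin_iff] at h1
    filter_upwards [h1] with z hz hcrit
    by_contra hne
    exact hz (fun hzx => hne (by rw [hzx])) (isCritical_coe.1 hcrit)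
  · filter_upwards [hd.continuous.continuousAt.eventually_ne hx] with z hz hcrit
    exact absurd (isCritical_coe.1 hcrit) hz

theorem IsMorse.finite_critical {h : Torus → ℝ} (hh : IsMorse h) : {c | IsCritical h c}.Finite := by
  have key : ({c | IsCritical h c} ∩ univ).Finite := by
    refine isCompact_univ.induction_on (p := fun s => ({c | IsCritical h c} ∩ s).Finite)
      (by simp) (fun s t hst ht => ht.subset (inter_subset_inter_right _ hst))
      (fun s t hs ht => by rw [inter_union_distrib_left]; exact hs.union ht) fun c _ => ?_
    refine ⟨{c' | IsCritical h c' → c' = c}, mem_nhdsWithin_of_mem_nhds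
      (hh.eventually_not_critical c), (finite_singleton c).subset ?_⟩
    rintro c' ⟨h1, h2⟩
    exact h2 h1
  rwa [inter_univ] at key

theorem isCritical_congr {h h' : Torus → ℝ} {c : Torus} (hh : h =ᶠ[𝓝 c] h') :
    IsCritical h c ↔ IsCritical h' c := by
  have hc : Continuous fun q : ℝ × ℝ =>
      ((c.1 + (q.1 : UnitAddCircle), c.2 + (q.2 : UnitAddCircle)) : Torus) :=
    (continuous_const.add (isOpenQuotientMap_coe_circle.continuous.comp continuous_fst)).prodMk
      (continuous_const.add (isOpenQuotientMap_coe_circle.continuous.comp continuous_snd))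
  have ht : Tendsto (fun q : ℝ × ℝ =>
      ((c.1 + (q.1 : UnitAddCircle), c.2 + (q.2 : UnitAddCircle)) : Torus)) (𝓝 0) (𝓝 c) := by
    simpa using hc.tendsto 0
  have he : inCoords h c =ᶠ[𝓝 0] inCoords h' c := ht.eventually hh
  rw [IsCritical, IsCritical, he.fderiv_eq]

end Torus

namespace Knot

/-- The critical cords of the energy are orthogonal to the knot at both endpoints. -/
theorem inner_eq_zero_of_isCritical {K : Knot} {c : Torus} (hc : Torus.IsCritical K.energy c) :
    inner ℝ (K.jet 1 c.1) (K.toFun c.2 - K.toFun c.1) = 0 ∧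
      inner ℝ (K.jet 1 c.2) (K.toFun c.1 - K.toFun c.2) = 0 := by
  obtain ⟨⟨x, y⟩, rfl⟩ := isOpenQuotientMap_coe_torus.surjective c
  have hz := Torus.isCritical_coe (x := (x, y)) |>.1 hc
  have hs : ContDiff ℝ ∞ (Torus.lift K.energy) :=
    contDiff_const.mul (((K.smooth.comp contDiff_fst).sub (K.smooth.comp contDiff_snd)).norm_sq ℝ)
  have hd := (hs.differentiable (by simp) (x, y)).hasFDerivAt
  rw [hz] at hd
  have e1 := hd.comp_hasDerivAt x ((hasDerivAt_id' x).prodMk (hasDerivAt_const x y))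
  have e2 := hd.comp_hasDerivAt y ((hasDerivAt_const y x).prodMk (hasDerivAt_id' y))
  have d1 := (((K.hasDerivAt x).sub_const (K.toFun y)).norm_sq).const_mul (1 / 2 : ℝ)
  have d2 := (((K.hasDerivAt y).const_sub (K.toFun x)).norm_sq).const_mul (1 / 2 : ℝ)
  have u1 := e1.unique d1
  have u2 := e2.unique d2
  simp only [zero_apply, inner_neg_right] at u1 u2
  constructor
  · change inner ℝ (K.jet 1 (x : UnitAddCircle)) (K.toFun y - K.toFun x) = 0
    rw [real_inner_comm, ← neg_sub, inner_neg_left]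
    linarith
  · change inner ℝ (K.jet 1 (y : UnitAddCircle)) (K.toFun x - K.toFun y) = 0
    rw [real_inner_comm]
    linarith

end Knot

/-! ### Regularity of the critical cords and the conclusion -/

namespace Knot

/-- The cords at which the closures of `S` and, for a suitable framing, of `F` can be avoided. -/
def IsRegularCord (K : Knot) (c : Torus) : Prop :=
  c ∉ closure K.S ∧ K.startDir c ≠ 0 ∧ K.startDir c.swap ≠ 0

theorem notMem_closure_S_of_eventually {K : Knot} {c : Torus}
    (h : ∀ᶠ c' : Torus in 𝓝 c, ∀ u, c'.1 ≠ c'.2 →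
      K.toFun u ∉ openSegment ℝ (K.toFun c'.1) (K.toFun c'.2)) : c ∉ closure K.S := by
  rw [mem_closure_iff_frequently]
  intro hf
  refine hf ?_
  filter_upwards [h] with c' hc' hS
  obtain ⟨hne, u, hu⟩ := hS
  exact hc' u hne hu

/-- The normal part of a short chord pairs positively with the curvature vector at `s`, so it cannot
vanish. -/
theorem eventually_startDir_ne_zero {K : Knot} (hK : K ∈ generic) (s : UnitAddCircle) :
    ∀ᶠ c : Torus in 𝓝 (s, s), K.startDir c ≠ 0 := by
  have hw : 0 < inner ℝ (K.curv s) (K.curv s) := real_inner_self_pos.2 (hK.1 s)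
  filter_upwards [K.eventually_inner_normalPart_pos hw] with c hc
  by_cases hne : c.1 = c.2
  · rw [startDir, if_pos hne]
    exact hK.1 c.1
  · rw [startDir, if_neg hne]
    intro h0
    have := hc hne
    rw [h0, inner_zero_right] at this
    exact lt_irrefl _ this

/-- Short cords of a generic knot are regular. -/
theorem eventually_isRegularCord {K : Knot} (hK : K ∈ generic) :
    ∀ᶠ c in 𝓝ˢ (diagonal UnitAddCircle), K.IsRegularCord c := by
  refine eventually_nhdsSet_iff_forall.2 ?_
  rintro ⟨s, t⟩ hst
  obtain rfl : s = t := hst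
  have h1 := (K.eventually_short_chord_clear K.injective (hK.1 s)).eventually_nhds
  have h2 := eventually_startDir_ne_zero hK s
  have h3 := (continuous_swap.tendsto ((s, s) : Torus)).eventually h2
  filter_upwards [h1, h2, h3] with c hc1 hc2 hc3
  exact ⟨notMem_closure_S_of_eventually hc1, hc2, hc3⟩

theorem startDir_ne_zero_of_inner_eq_zero {K : Knot} {c : Torus} (hne : c.1 ≠ c.2)
    (h : inner ℝ (K.jet 1 c.1) (K.toFun c.2 - K.toFun c.1) = 0) : K.startDir c ≠ 0 := by
  have himm : K.jet 1 c.1 ≠ 0 := K.immersion c.1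
  rw [startDir, if_neg hne, normalPart_of_inner_eq_zero h]
  exact smul_ne_zero (pow_ne_zero 2 (norm_ne_zero_iff.2 himm))
    (sub_ne_zero.2 (K.injective.ne hne.symm))

/-- The nonconstant critical cords of the energy of a generic knot are regular. -/
theorem isRegularCord_of_isCritical {K : Knot} (hK : K ∈ generic) {c : Torus} (hne : c.1 ≠ c.2)
    (hc : Torus.IsCritical K.energy c) : K.IsRegularCord c := by
  obtain ⟨h1, h2⟩ := inner_eq_zero_of_isCritical hc
  refine ⟨notMem_closure_S_of_eventually ?_, startDir_ne_zero_of_inner_eq_zero hne h1,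
    startDir_ne_zero_of_inner_eq_zero (c := c.swap) hne.symm h2⟩
  have h : ∀ᶠ c' : Torus in 𝓝 c, ∀ u ∈ (univ : Set UnitAddCircle),
      K.toFun u ∉ openSegment ℝ (K.toFun c'.1) (K.toFun c'.2) := by
    refine isCompact_univ.eventually_forall_of_forall_eventually fun u _ => ?_
    have hcont : Continuous fun q : Torus × UnitAddCircle => (K.toSmoothLoop, q) := by fun_prop
    exact (hcont.tendsto (c, u)).eventually
      (eventually_notMem_openSegment hK.2.1 hne h1 h2 (hK.2.2 c.1 c.2 u hne h1 h2))
  filter_upwards [h] with c' hc' u _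
  exact hc' u (mem_univ _)

/-- There is a neighbourhood of the diagonal such that perturbations of the energy supported in it
have regular critical cords only. -/
theorem exists_nhds_isRegularCord {K : Knot} (hK : K ∈ generic) :
    ∃ U ∈ 𝓝ˢ (diagonal UnitAddCircle), ∀ f : Torus → ℝ, (∀ c, c ∉ U → f c = 0) →
      ∀ c, Torus.IsCritical (K.energy + f) c → K.IsRegularCord c := by
  obtain ⟨V, hV, hdV, hVreg⟩ := mem_nhdsSet_iff_exists.1 (eventually_isRegularCord hK)
  -- The closure of `U` lies in `V`, so outside `V` the perturbation vanishes on a whole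
  -- neighbourhood and leaves the derivative of the energy unchanged.
  obtain ⟨U, hU, hdU, hUV⟩ := normal_exists_closure_subset isClosed_diagonal hV hdV
  refine ⟨U, hU.mem_nhdsSet.2 hdU, fun f hf c hc => ?_⟩
  by_cases hcV : c ∈ V
  · exact hVreg hcV
  have hev : K.energy + f =ᶠ[𝓝 c] K.energy := by
    filter_upwards [isClosed_closure.isOpen_compl.mem_nhds fun h => hcV (hUV h)] with c' hc'
    simp [hf c' fun h => hc' (subset_closure h)]
  exact isRegularCord_of_isCritical hK (fun h => hcV (hdV h)) ((Torus.isCritical_congr hev).1 hc)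

end Knot

/-- A connected circle with more than one point has no isolated points, so complements of finite
sets are dense. -/
instance : Nontrivial UnitAddCircle := by
  refine ⟨((1 / 2 : ℝ) : UnitAddCircle), ((0 : ℝ) : UnitAddCircle), fun h => ?_⟩
  have h1 := (AddCircle.coe_eq_coe_iff_of_mem_Ico (p := (1 : ℝ)) (a := 0)
    ⟨by norm_num, by norm_num⟩ ⟨by norm_num, by norm_num⟩).1 h
  norm_num at h1

theorem isOpen_compl_and_dense_of_finite {A : Set UnitAddCircle} (hA : A.Finite) :
    IsOpen Aᶜ ∧ Dense Aᶜ := by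
  refine ⟨hA.isClosed.isOpen_compl, ?_⟩
  rw [compl_eq_univ_sdiff]
  exact dense_univ.sdiff_finite hA

/-- For a generic (open and dense in the `C^∞` topology) knot `K`, every Morse function `E + f`
obtained from the energy function by a perturbation `f` supported in a small neighbourhood of the
diagonal, a generic base point `p` and a generic framing `ν`, no critical point of index 0 or 1 of
`E + f` lies in `B ∪ F ∪ S`, nor in the limit cords of `F` and `S`. -/
theorem mainTheorem8 :
    ∃ G : Set Knot, IsOpen G ∧ Dense G ∧ ∀ K ∈ G,
      ∃ U ∈ 𝓝ˢ (diagonal UnitAddCircle), ∀ f : Torus → ℝ, K.IsMorsePerturbation U f →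
        ∃ P : Set UnitAddCircle, IsOpen P ∧ Dense P ∧
        ∃ N : Set K.Framing, IsOpen N ∧ Dense N ∧
          ∀ p ∈ P, ∀ ν ∈ N,
            (Torus.Crit 0 (K.energy + f) ∪ Torus.Crit 1 (K.energy + f)) ∩
              (Knot.B p ∪ closure (K.F ν) ∪ closure K.S) = ∅ := by
  refine ⟨Knot.generic, Knot.isOpen_generic, Knot.dense_generic, fun K hK => ?_⟩
  obtain ⟨U, hU, hreg⟩ := Knot.exists_nhds_isRegularCord hK
  refine ⟨U, hU, fun f hf => ?_⟩
  have hfin := hf.morse.finite_critical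
  set C := {c | Torus.IsCritical (K.energy + f) c} with hC
  obtain ⟨hP, hP'⟩ := isOpen_compl_and_dense_of_finite
    ((hfin.image Prod.fst).union (hfin.image Prod.snd))
  set dir : Torus → UnitAddCircle × E3 := fun c => (c.1, ‖K.startDir c‖⁻¹ • K.startDir c) with hdir
  -- Each critical cord forbids one framing vector at its startpoint and, through the swapped cord,
  -- one at its endpoint.
  obtain ⟨hN, hN'⟩ := Knot.Framing.isOpen_and_dense_of_finite (K := K)
    ((hfin.image dir).union (hfin.image fun c => dir c.swap))
  refine ⟨_, hP, hP', _, hN, hN', fun p hp ν hν => ?_⟩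
  rw [eq_empty_iff_forall_notMem]
  rintro c ⟨hcrit, hbad⟩
  have hc : c ∈ C := hcrit.elim (fun h => h.1) (fun h => h.1)
  obtain ⟨hS, hd, hd'⟩ := hreg f hf.vanishes c hc
  rcases hbad with (hB | hF) | hS'
  · rcases hB with h | h
    · exact hp (Or.inl ⟨c, hc, h⟩)
    · exact hp (Or.inr ⟨c, hc, h⟩)
  · rw [Knot.F, closure_union] at hF
    rcases hF with h | h
    · exact Knot.notMem_closure_Fs hd (hν (dir c) (Or.inl ⟨c, hc, rfl⟩)) h
    · exact Knot.notMem_closure_Fs hd' (hν (dir c.swap) (Or.inr ⟨c, hc, rfl⟩))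
        (Knot.mem_closure_Fe h)
  · exact hS hS'

end
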